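/- **Model.** In the CongestedClique with $n$ machines, the input is a graph $G$ on the vertex set $\{1,\dots,n\}$; machine $i$ initially knows $n$, its ID $i$ and the neighbours of vertex $i$ in $G$. Computation proceeds in synchronous rounds: in each round every machine performs unbounded local computation with private randomness and then sends to every machine a (possibly different) message of $O(\log n)$ bits. An algorithm finishes when every machine has produced its (irrevocable) output; the number of rounds used until then is a random variable. **Cover time.** For a connected graph $G$ on $n$ vertices, the cover time is $\tau=\tau(G)=\max_{v}\mathbb E_v[T_{\mathrm{cov}}]$, where $T_{\mathrm{cov}}$ is the first time at which the simple random walk on $G$ (which moves to a uniformly random neighbour in each step) started at $v$ has visited every vertex. **Corollary.** There is a randomized CongestedClique algorithm (which is not given $\tau$) and a constant $k$ such that the following holds. 1. On every connected graph $G$, with probability $1$ all machines eventually output one and the same spanning tree of $G$, and this tree is distributed uniformly over all spanning trees of $G$. 2. The number of rounds is $\tilde O(\tau/n)$ with high probability: for every constant $c>0$ there is a constant $C>0$ such that for every $n$ and every connected $n$-vertex graph $G$ with cover time $\tau$, the algorithm uses at most $C\,\frac{\tau}{n}\,(\log n)^k$ rounds with probability at least $1-n^{-c}$. -/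

import Mathlib

open MeasureTheory ProbabilityTheory
open scoped ENNReal NNReal

noncomputable section

namespace CClique

/-! ### Spanning trees, the simple random walk and the cover time -/

/-- The spanning trees of a graph `G` on the vertex set `Fin n`, as subgraphs on all vertices. -/
def spanningTrees {n : ℕ} (G : SimpleGraph (Fin n)) : Set (SimpleGraph (Fin n)) :=
  {T | T ≤ G ∧ T.IsTree}

open Classical in
/-- One step of the simple random walk: move to a uniformly random neighbour
(a vertex without neighbours stays where it is). -/
def walkStep {n : ℕ} (G : SimpleGraph (Fin n)) (v : Fin n) : PMF (Fin n) :=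
  if h : (G.neighborFinset v).Nonempty then PMF.uniformOfFinset (G.neighborFinset v) h
  else PMF.pure v

/-- The transition kernel of the simple random walk. -/
def walkKernel {n : ℕ} (G : SimpleGraph (Fin n)) : Kernel (Fin n) (Fin n) :=
  Kernel.ofFunOfCountable fun v => (walkStep G v).toMeasure

instance {n : ℕ} (G : SimpleGraph (Fin n)) : IsMarkovKernel (walkKernel G) :=
  ⟨fun v => PMF.toMeasure.isProbabilityMeasure (walkStep G v)⟩

/-- The transition kernel from the history up to time `t` to the position at time `t + 1`;
it only looks at the position at time `t`. -/
def historyKernel {n : ℕ} (G : SimpleGraph (Fin n)) (t : ℕ) :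
    Kernel ((i : Finset.Iic t) → (fun _ : ℕ => Fin n) i) (Fin n) :=
  (walkKernel G).comap (fun h => h ⟨t, Finset.mem_Iic.2 le_rfl⟩) (measurable_pi_apply _)

instance {n : ℕ} (G : SimpleGraph (Fin n)) (t : ℕ) : IsMarkovKernel (historyKernel G t) := by
  unfold historyKernel
  infer_instance

/-- The law of the infinite trajectory of the simple random walk on `G` started at `v`. -/
def walkLaw {n : ℕ} (G : SimpleGraph (Fin n)) (v : Fin n) : Measure (ℕ → Fin n) :=
  Kernel.traj (X := fun _ => Fin n) (historyKernel G) 0 (fun _ => v)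

/-- The first time at which a trajectory has visited every vertex (`∞` if there is none). -/
def timeToCover {n : ℕ} (ω : ℕ → Fin n) : ℝ≥0∞ :=
  ⨅ (t : ℕ) (_ : ∀ u, ∃ s ≤ t, ω s = u), (t : ℝ≥0∞)

/-- The cover time of `G`: the expected time that the simple random walk needs to visit every
vertex, for the worst starting vertex. -/
def coverTime {n : ℕ} (G : SimpleGraph (Fin n)) : ℝ≥0∞ :=
  ⨆ v, ∫⁻ ω, timeToCover ω ∂(walkLaw G v)

/-! ### The congested clique -/

/-- Independent sampling: the joint law of independent draws from `p 0, …, p (n - 1)`. -/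
def indep {α : Type} : {n : ℕ} → (Fin n → PMF α) → PMF (Fin n → α)
  | 0, _ => PMF.pure Fin.elim0
  | _ + 1, p => (p 0).bind fun a => (indep (Fin.tail p)).map fun f => Fin.cons a f

/-- A message in the clique of `n` machines: a string of `B ⌈log₂ n⌉` bits. -/
abbrev Message (B n : ℕ) : Type := Fin (B * Nat.clog 2 n) → Bool

/-- A randomized algorithm for `n` machines in the congested clique that outputs a graph.
Machine `i` hosts vertex `i`; local computation and memory are unbounded. -/
structure Algorithm (B n : ℕ) where
  /-- Local states of a machine. -/
  State : Type
  /-- Initial state of a machine, given its ID and the neighbours of the vertex that it hosts. -/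
  init : Fin n → Set (Fin n) → State
  /-- Local computation at the beginning of a round, with private randomness: it yields a new state
  and the messages to be sent in this round, one for each machine. -/
  compute : Fin n → State → PMF (State × (Fin n → Message B n))
  /-- New state at the end of a round, given the messages received, one from each machine. -/
  receive : Fin n → State → (Fin n → Message B n) → State
  /-- The output of a machine; `none` means that it has not produced its output yet. -/
  output : State → Option (SimpleGraph (Fin n))
  /-- An output is final. -/
  output_final : ∀ (i : Fin n) (s : State) (T : SimpleGraph (Fin n)), output s = some T →
    ∀ r ∈ (compute i s).support, ∀ m, output (receive i r.1 m) = some T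

namespace Algorithm

variable {B n : ℕ} (A : Algorithm B n)

/-- One synchronous round: all machines compute with independent private randomness, then machine
`i` receives from each machine `j` the message that `j` addressed to `i`. -/
def round (s : Fin n → A.State) : PMF (Fin n → A.State) :=
  (indep fun i => A.compute i (s i)).map fun r i => A.receive i (r i).1 fun j => (r j).2 i

/-- The law of the global state after `t` rounds on the input graph `G`. -/
def run (G : SimpleGraph (Fin n)) : ℕ → PMF (Fin n → A.State)
  | 0 => PMF.pure fun i => A.init i (G.neighborSet i)
  | t + 1 => (run G t).bind A.round

/-- The probability that some machine has not produced its output within `t` rounds, that is,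
that the algorithm uses more than `t` rounds on the input graph `G`. -/
def probUnfinished (G : SimpleGraph (Fin n)) (t : ℕ) : ℝ≥0∞ :=
  (A.run G t).toOuterMeasure {s | ∃ i, A.output (s i) = none}

/-- The probability that, on the input graph `G`, all machines eventually output the graph `T`.
As outputs are final, these events increase with the number `t` of rounds. -/
def probOutput (G T : SimpleGraph (Fin n)) : ℝ≥0∞ :=
  ⨆ t, (A.run G t).toOuterMeasure {s | ∀ i, A.output (s i) = some T}

/-- On the input graph `G`, the common output of the machines is a uniformly random spanning tree
of `G`. The probabilities add up to `1` if `G` is connected. -/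
def SamplesUniformSpanningTree (G : SimpleGraph (Fin n)) : Prop :=
  ∀ T ∈ spanningTrees G, A.probOutput G T = ((spanningTrees G).ncard : ℝ≥0∞)⁻¹

end Algorithm

end CClique

end

/-! The algorithm is Wilson's cycle popping on stacks shared by all machines. Every vertex carries
an infinite stack of independent walk steps, and cycles of visible arrows are popped until the
visible arrows lead to the root `0`. No order of popping is fixed; its possible states are replaced
by `Balanced` depths `d`. At most one balanced `d` has visible arrows that lead to the root
(`Balanced.unique`), and a balanced `d` without this property can be enlarged
(`Balanced.exists_lt`).

Uniformity: whether `d` is balanced depends only on arrows strictly above `d`, while the resulting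
tree is read off the arrows at `d`. These are independent, so each tree has weight proportional to
the product of `1 / deg v` over the non-root vertices, the same for all spanning trees. This
survives truncating the stacks to `l v` arrows (`stackLaw_resolves_tree`), so retrying with longer
stacks after a failure creates no bias.

Cost: popping removes fewer arrows of `v` than the walk from `v` to the root makes departures from
`v` (`lt_of_hits`). That number is geometric with mean `π(v)`, the stationary probability `deg v / ∑
deg`, times the commute time of `v` and the root, hence mean at most `2 π(v) τ` (`exists_escape`,
`hittingTime_le_coverTime`). With two relayed samples per machine and round, every `v` can receive
at least `n π(v)` arrows per round (`exists_schedule`). After `b` batches a given vertex fails with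
probability at most `exp (-b n / (2 τ))`; `π(v)` has cancelled. A union bound then gives `b` of
order `(τ / n) log n`. Finally, `run_toOuterMeasure` and `map_stacks` identify the law of the
distributed execution with that of popping on independent stacks. -/

noncomputable section

namespace CClique

/-! ### Cycle popping on stacks of arrows -/

section Stacks

variable {V : Type*} [DecidableEq V]

/-- The arrows that are visible when `d v` arrows have been removed from the stack of `v`;
the root points to itself. -/
def tops (r : V) (ω : V × ℕ → V) (d : V → ℕ) (v : V) : V :=
  if v = r then r else ω (v, d v)

/-- Following the arrows `f` from any vertex leads to the root. -/
def LeadsTo (r : V) (f : V → V) : Prop := ∀ v, ∃ k, f^[k] v = r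

/-- Remove the first arrow from the stack of `x`. -/
def dropTop (x : V) (ω : V × ℕ → V) : V × ℕ → V :=
  fun i => if i.1 = x then ω (i.1, i.2 + 1) else ω i

/-- Put the arrow `a` on the stack of `x`. -/
def pushTop (x a : V) (ω : V × ℕ → V) : V × ℕ → V :=
  fun i => if i.1 = x then (if i.2 = 0 then a else ω (i.1, i.2 - 1)) else ω i

/-- The walk from `x` that consumes the arrows of the stacks reaches `r` within `t` steps and leaves
`v` at most `k` times before that. -/
def Hits (r v : V) : ℕ → V → ℕ → (V × ℕ → V) → Prop
  | 0, x, _, _ => x = r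
  | t + 1, x, k, ω => x = r ∨
      if x = v then ∃ j, k = j + 1 ∧ Hits r v t (ω (x, 0)) j (dropTop x ω)
      else Hits r v t (ω (x, 0)) k (dropTop x ω)

lemma dropTop_pushTop (x a : V) (ω : V × ℕ → V) : dropTop x (pushTop x a ω) = ω := by
  funext ⟨y, k⟩
  by_cases h : y = x <;> simp [dropTop, pushTop, h]

lemma pushTop_top (x a : V) (ω : V × ℕ → V) : pushTop x a ω (x, 0) = a := by
  simp [pushTop]

/-- An orbit that misses the root is a nonempty forward-closed set. The image of a minimal such set
is again one, hence equals it; it plays the role of a cycle. -/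
lemma exists_invariant_of_not_leadsTo [Finite V] {r : V} {f : V → V} (h : ¬ LeadsTo r f) :
    ∃ C : Finset V, C.Nonempty ∧ r ∉ C ∧ C.image f = C := by
  classical
  have := Fintype.ofFinite V
  simp only [LeadsTo, not_forall, not_exists] at h
  obtain ⟨v, hv⟩ := h
  let P : Finset V → Prop := fun C => C.Nonempty ∧ r ∉ C ∧ C.image f ⊆ C
  have h0 : P (Finset.univ.filter fun x => ∃ k, f^[k] v = x) := by
    refine ⟨⟨v, by simpa using ⟨0, rfl⟩⟩, by simpa using hv, ?_⟩
    intro x hx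
    simp only [Finset.mem_image, Finset.mem_filter, Finset.mem_univ, true_and] at hx ⊢
    obtain ⟨_, ⟨k, rfl⟩, rfl⟩ := hx
    exact ⟨k + 1, Function.iterate_succ_apply' f k v⟩
  obtain ⟨C, -, hC⟩ := exists_minimal_le_of_wellFoundedLT P _ h0
  refine ⟨C, hC.1.1, hC.1.2.1, ?_⟩
  have hsub := hC.1.2.2
  refine le_antisymm hsub (hC.2 ⟨hC.1.1.image f, fun hr => hC.1.2.1 (hsub hr), ?_⟩ hsub)
  exact Finset.image_subset_image hsub

variable [Fintype V]

/-- The number of arrows that lie above the depths `d` and point to `x`. -/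
def indegree (ω : V × ℕ → V) (d : V → ℕ) (x : V) : ℕ :=
  ∑ y, ((Finset.range (d y)).filter fun k => ω (y, k) = x).card

/-- The arrows above the depths `d` enter each vertex as often as they leave it,
and none of them leaves the root. -/
def Balanced (r : V) (ω : V × ℕ → V) (d : V → ℕ) : Prop :=
  d r = 0 ∧ ∀ x, indegree ω d x = d x

lemma indegree_eq_dropTop_add (ω : V × ℕ → V) (d : V → ℕ) {y : V} (hy : 0 < d y) (x : V) :
    indegree ω d x =
      indegree (dropTop y ω) (Function.update d y (d y - 1)) x + if ω (y, 0) = x then 1 else 0 := by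
  unfold indegree
  rw [← Finset.add_sum_erase _ _ (Finset.mem_univ y),
    ← Finset.add_sum_erase _ _ (Finset.mem_univ y)]
  have h1 : ∑ z ∈ Finset.univ.erase y,
      ((Finset.range (d z)).filter fun k => ω (z, k) = x).card
      = ∑ z ∈ Finset.univ.erase y, ((Finset.range (Function.update d y (d y - 1) z)).filter
          fun k => dropTop y ω (z, k) = x).card := by
    refine Finset.sum_congr rfl fun z hz => ?_
    have hz' : z ≠ y := Finset.ne_of_mem_erase hz
    simp [dropTop, hz']
  rw [h1]
  obtain ⟨m, hm⟩ : ∃ m, d y = m + 1 := ⟨d y - 1, by omega⟩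
  have h2 : ((Finset.range (d y)).filter fun k => ω (y, k) = x).card
      = ((Finset.range (Function.update d y (d y - 1) y)).filter
          fun k => dropTop y ω (y, k) = x).card + if ω (y, 0) = x then 1 else 0 := by
    simp only [Function.update_self, hm, Nat.add_sub_cancel, Finset.card_filter]
    rw [Finset.sum_range_succ']
    simp [dropTop]
  omega

/-- A balanced family of depths stays below the number of times that the walk from `v` leaves `v`
on its way to the root. -/
lemma lt_of_hits {r v : V} (hv : v ≠ r) : ∀ (t : ℕ) (y : V) (k : ℕ) (ω : V × ℕ → V) (d : V → ℕ),
    d r = 0 →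
    (∀ x, indegree ω d x + (if y = x then 1 else 0) = d x + if v = x then 1 else 0) →
    Hits r v t y k ω → d v < k := by
  -- The balance hypothesis says that the arrows above `d` have the degrees of a trail from the
  -- current position `y` to `v`. The walk consumes that trail arrow by arrow, which preserves the
  -- hypothesis.
  intro t
  induction t with
  | zero =>
    intro y k ω d hd hb hh
    have := hb r
    simp only [Hits] at hh
    simp [hh, hd, hv] at this
  | succ t ih =>
    intro y k ω d hd hb hh
    by_cases hyr : y = r
    · have := hb r
      simp [hyr, hd, hv] at this
    simp only [Hits, hyr, false_or] at hh
    -- If no arrow of `y` is left, balance forces `y = v`; the walk is not yet at the root, so one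
    -- more departure from `v` is due, whence strict inequality.
    rcases Nat.eq_zero_or_pos (d y) with h0 | h0
    · have h1 := hb y
      by_cases hvy : v = y
      · subst hvy
        simp only [if_true] at hh
        obtain ⟨j, rfl, -⟩ := hh
        omega
      · simp [h0, hvy] at h1
    · have hb' : ∀ x, indegree (dropTop y ω) (Function.update d y (d y - 1)) x +
          (if ω (y, 0) = x then 1 else 0) =
          Function.update d y (d y - 1) x + if v = x then 1 else 0 := by
        intro x
        rw [← indegree_eq_dropTop_add ω d h0 x]
        have h1 := hb x
        by_cases hx : y = x
        · subst hx
          simp only [if_true, Function.update_self] at h1 ⊢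
          omega
        · rw [if_neg hx] at h1
          rw [Function.update_of_ne (Ne.symm hx)]
          omega
      have hd' : Function.update d y (d y - 1) r = 0 := by
        rw [Function.update_of_ne (Ne.symm hyr), hd]
      by_cases hyv : y = v
      · subst hyv
        simp only [if_true] at hh
        obtain ⟨j, rfl, hj⟩ := hh
        have := ih _ _ _ _ hd' hb' hj
        simp only [Function.update_self] at this
        omega
      · simp only [hyv, if_false] at hh
        have := ih _ _ _ _ hd' hb' hh
        rwa [Function.update_of_ne (Ne.symm hyv)] at this

lemma Balanced.lt_of_hits {r v : V} (hv : v ≠ r) {ω : V × ℕ → V} {d : V → ℕ}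
    (hd : Balanced r ω d) {t k : ℕ} (h : Hits r v t v k ω) : d v < k :=
  CClique.lt_of_hits hv t v k ω d hd.1 (fun x => by rw [hd.2 x]) h

lemma balanced_zero (r : V) (ω : V × ℕ → V) : Balanced r ω 0 := by
  simp [Balanced, indegree]

lemma sum_indegree (ω : V × ℕ → V) (d : V → ℕ) (U : Finset V) :
    ∑ x ∈ U, indegree ω d x =
      ∑ y, ((Finset.range (d y)).filter fun k => ω (y, k) ∈ U).card := by
  unfold indegree
  rw [Finset.sum_comm]
  refine Finset.sum_congr rfl fun y _ => ?_
  simp only [Finset.card_filter]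
  rw [Finset.sum_comm]
  refine Finset.sum_congr rfl fun k _ => ?_
  simp

/-- Balanced depths lie below the balanced depths at which the visible arrows lead to the root. -/
lemma Balanced.le_of_leadsTo {r : V} {ω : V × ℕ → V} {d e : V → ℕ} (hd : Balanced r ω d)
    (he : Balanced r ω e) (ht : LeadsTo r (tops r ω e)) : d ≤ e := by
  by_contra hcon
  obtain ⟨v, hv⟩ : ∃ v, e v < d v := by
    simpa [Pi.le_def] using hcon
  -- If the arrows visible at `e` stayed inside `U`, they could not lead from `v` to the root, which
  -- lies outside `U`.
  let U : Finset V := Finset.univ.filter fun x => e x < d x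
  have hr : r ∉ U := by simp [U, hd.1]
  have hU : ∀ x, x ∈ U ↔ e x < d x := by simp [U]
  suffices hclosed : ∀ x ∈ U, tops r ω e x ∈ U by
    have hit : ∀ k, (tops r ω e)^[k] v ∈ U := by
      intro k
      induction k with
      | zero => simpa using (hU v).2 hv
      | succ k ih => rw [Function.iterate_succ_apply']; exact hclosed _ ih
    obtain ⟨k, hk⟩ := ht v
    exact hr (hk ▸ hit k)
  have hsd : ∑ x ∈ U, d x =
      ∑ y, ((Finset.range (d y)).filter fun k => ω (y, k) ∈ U).card := by
    rw [← sum_indegree]; exact Finset.sum_congr rfl fun x _ => (hd.2 x).symm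
  have hse : ∑ x ∈ U, e x =
      ∑ y, ((Finset.range (e y)).filter fun k => ω (y, k) ∈ U).card := by
    rw [← sum_indegree]; exact Finset.sum_congr rfl fun x _ => (he.2 x).symm
  intro x hx
  have hxr : x ≠ r := fun h => hr (h ▸ hx)
  by_contra hout
  have hout' : ω (x, e x) ∉ U := by simpa [tops, hxr] using hout
  -- Arrows into `U` are counted. By balance, passing from `e` to `d` must supply `∑ y ∈ U, (d y - e
  -- y)` additional ones. Only vertices of `U` can gain any, at most one for each extra arrow, so
  -- every extra arrow must point into `U`; the one at depth `e x` does not.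
  have key : ∀ y, ((Finset.range (d y)).filter fun k => ω (y, k) ∈ U).card ≤
      ((Finset.range (e y)).filter fun k => ω (y, k) ∈ U).card +
        if y ∈ U then d y - e y else 0 := by
    intro y
    by_cases hy : y ∈ U
    · have hlt := (hU y).1 hy
      simp only [hy, if_true, Finset.card_filter]
      rw [← Finset.sum_range_add_sum_Ico _ hlt.le]
      gcongr
      calc _ ≤ ∑ k ∈ Finset.Ico (e y) (d y), 1 :=
            Finset.sum_le_sum fun k _ => by split_ifs <;> simp
        _ = _ := by simp
    · have hle : d y ≤ e y := by simpa [hU] using hy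
      simp only [hy, if_false, add_zero]
      exact Finset.card_le_card (Finset.filter_subset_filter _ (Finset.range_subset_range.2 hle))
  have keyx : ((Finset.range (d x)).filter fun k => ω (x, k) ∈ U).card <
      ((Finset.range (e x)).filter fun k => ω (x, k) ∈ U).card +
        if x ∈ U then d x - e x else 0 := by
    have hlt := (hU x).1 hx
    simp only [hx, if_true, Finset.card_filter]
    rw [← Finset.sum_range_add_sum_Ico _ hlt.le]
    gcongr
    calc _ < ∑ k ∈ Finset.Ico (e x) (d x), 1 := by
          refine Finset.sum_lt_sum (fun k _ => by split_ifs <;> simp) ⟨e x, by simp [hlt], ?_⟩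
          simp [hout']
      _ = _ := by simp
  have := Finset.sum_lt_sum (fun y (_ : y ∈ Finset.univ) => key y) ⟨x, Finset.mem_univ x, keyx⟩
  rw [← hsd, Finset.sum_add_distrib, ← hse, Finset.sum_ite_mem, Finset.univ_inter,
    ← Finset.sum_add_distrib] at this
  refine absurd this (not_lt.2 (Finset.sum_le_sum fun y hy => ?_))
  have := (hU y).1 hy
  omega

lemma Balanced.unique {r : V} {ω : V × ℕ → V} {d e : V → ℕ} (hd : Balanced r ω d)
    (he : Balanced r ω e) (htd : LeadsTo r (tops r ω d)) (hte : LeadsTo r (tops r ω e)) : d = e :=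
  le_antisymm (hd.le_of_leadsTo he hte) (he.le_of_leadsTo hd htd)

/-- If the visible arrows contain a cycle, it can be popped. -/
lemma Balanced.exists_lt {r : V} {ω : V × ℕ → V} {d : V → ℕ} (hd : Balanced r ω d)
    (ht : ¬ LeadsTo r (tops r ω d)) : ∃ e, Balanced r ω e ∧ d < e := by
  obtain ⟨C, ⟨v, hv⟩, hr, hC⟩ := exists_invariant_of_not_leadsTo ht
  -- A surjection of a finite set onto itself permutes it, so popping one arrow at each vertex of
  -- `C` adds one entry and one departure there.
  have hinj : Set.InjOn (tops r ω d) C := Finset.card_image_iff.1 (by rw [hC])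
  have hne : ∀ y ∈ C, y ≠ r := fun y hy h => hr (h ▸ hy)
  refine ⟨fun x => d x + if x ∈ C then 1 else 0, ⟨by simp [hr, hd.1], fun x => ?_⟩, ?_⟩
  · have h1 : indegree ω (fun x => d x + if x ∈ C then 1 else 0) x =
        indegree ω d x + ∑ y ∈ C, if tops r ω d y = x then 1 else 0 := by
      unfold indegree
      rw [← Finset.univ_inter C, ← Finset.sum_ite_mem, ← Finset.sum_add_distrib]
      refine Finset.sum_congr rfl fun y _ => ?_
      by_cases hy : y ∈ C
      · simp only [Finset.univ_inter, hy, if_true, Finset.card_filter]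
        rw [Finset.sum_range_succ]
        simp [tops, hne y hy]
      · simp [hy]
    rw [h1, hd.2 x]
    congr 1
    by_cases hx : x ∈ C
    · obtain ⟨y, hy, hyx⟩ := Finset.mem_image.1 (hC.symm ▸ hx)
      rw [Finset.sum_eq_single y]
      · simp [hyx, hx]
      · intro z hz hzy
        rw [if_neg]
        exact fun h => hzy (hinj hz hy (h.trans hyx.symm))
      · exact fun h => absurd hy h
    · rw [if_neg hx]
      refine Finset.sum_eq_zero fun y hy => ?_
      rw [if_neg]
      rintro rfl
      exact hx (hC ▸ Finset.mem_image_of_mem _ hy)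
  · refine Pi.lt_def.2 ⟨fun x => Nat.le_add_right _ _, v, by simp [hv]⟩

/-- If all walks reach the root, then popping ends, and it consumes fewer arrows of each vertex than
the walk started there. -/
lemma exists_balanced_leadsTo {r : V} {ω : V × ℕ → V} {l : V → ℕ}
    (h : ∀ v ≠ r, ∃ t, Hits r v t v (l v) ω) :
    ∃ d, Balanced r ω d ∧ LeadsTo r (tops r ω d) ∧ ∀ v ≠ r, d v < l v := by
  have hlt : ∀ d, Balanced r ω d → ∀ v ≠ r, d v < l v := fun d hd v hv => by
    obtain ⟨t, ht⟩ := h v hv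
    exact hd.lt_of_hits hv ht
  -- All balanced depths lie below `l`, so a maximal one exists, and it has no cycle left to pop.
  have hfin : {d : V → ℕ | Balanced r ω d}.Finite := by
    refine (Set.finite_Iic l).subset fun d hd v => ?_
    by_cases hv : v = r
    · subst hv; simp [hd.1]
    · exact (hlt d hd v hv).le
  obtain ⟨d, hd⟩ := hfin.exists_maximal ⟨0, balanced_zero r ω⟩
  refine ⟨d, hd.1, ?_, hlt d hd.1⟩
  by_contra hcon
  obtain ⟨e, he, hde⟩ := Balanced.exists_lt hd.1 hcon
  exact hde.not_ge (hd.2 he hde.le)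

lemma indegree_congr {ω ω' : V × ℕ → V} {d : V → ℕ}
    (h : ∀ v, ∀ k < d v, ω (v, k) = ω' (v, k)) (x : V) : indegree ω d x = indegree ω' d x := by
  unfold indegree
  refine Finset.sum_congr rfl fun y _ => ?_
  congr 1
  refine Finset.filter_congr fun k hk => ?_
  rw [h y k (Finset.mem_range.1 hk)]

lemma Balanced.congr {r : V} {ω ω' : V × ℕ → V} {d : V → ℕ}
    (h : ∀ v, ∀ k < d v, ω (v, k) = ω' (v, k)) (hd : Balanced r ω d) : Balanced r ω' d :=
  ⟨hd.1, fun x => by rw [← indegree_congr h, hd.2]⟩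

end Stacks

/-! ### Parent functions and spanning trees -/

section ParentFunctions

variable {V : Type*}

/-- The graph with an edge from each vertex to its parent. -/
def parentGraph (f : V → V) : SimpleGraph V := SimpleGraph.fromRel fun v w => f v = w

lemma parentGraph_adj {f : V → V} {v w : V} :
    (parentGraph f).Adj v w ↔ v ≠ w ∧ (f v = w ∨ f w = v) := by
  simp [parentGraph, SimpleGraph.fromRel_adj]

lemma LeadsTo.ne_self {r : V} {f : V → V} (h : LeadsTo r f) {v : V} (hv : v ≠ r) : f v ≠ v := by
  intro hf
  obtain ⟨k, hk⟩ := h v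
  rw [Function.iterate_fixed hf] at hk
  exact hv hk

lemma LeadsTo.apply_apply_ne {r : V} {f : V → V} (h : LeadsTo r f) {v : V} (hv : v ≠ r)
    (hfv : f v ≠ r) : f (f v) ≠ v := by
  intro hf
  have hall : ∀ k, f^[k] v = v ∨ f^[k] v = f v := by
    intro k
    induction k with
    | zero => exact Or.inl rfl
    | succ k ih =>
      rw [Function.iterate_succ_apply']
      rcases ih with h | h <;> rw [h]
      · exact Or.inr rfl
      · exact Or.inl hf
  obtain ⟨k, hk⟩ := h v
  rcases hall k with h | h
  · exact hv (h ▸ hk)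
  · exact hfv (h ▸ hk)

lemma LeadsTo.connected {r : V} {f : V → V} (h : LeadsTo r f) : (parentGraph f).Connected := by
  have hr : ∀ v, (parentGraph f).Reachable v r := by
    intro v
    obtain ⟨k, hk⟩ := h v
    rw [← hk]
    clear hk
    induction k with
    | zero => exact SimpleGraph.Reachable.refl _
    | succ k ih =>
      rw [Function.iterate_succ_apply']
      refine ih.trans ?_
      by_cases hs : f^[k] v = f (f^[k] v)
      · rw [← hs]
      · exact SimpleGraph.Adj.reachable (parentGraph_adj.2 ⟨hs, Or.inl rfl⟩)
  have : Nonempty V := ⟨r⟩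
  exact ⟨fun v w => (hr v).trans (hr w).symm⟩

/-- Connectedness together with an edge count: every edge is `s(v, f v)` for some `v ≠ r`. -/
lemma LeadsTo.isTree [Finite V] {r : V} {f : V → V} (h : LeadsTo r f) (hr : f r = r) :
    (parentGraph f).IsTree := by
  classical
  have := Fintype.ofFinite V
  refine SimpleGraph.isTree_iff_connected_and_card.2 ⟨h.connected, ?_⟩
  refine le_antisymm ?_ h.connected.card_vert_le_card_edgeSet_add_one
  have hsub : (parentGraph f).edgeSet ⊆
      ((Finset.univ.erase r).image fun v => s(v, f v) : Finset (Sym2 V)) := by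
    intro e
    induction e with
    | h v w =>
      rw [SimpleGraph.mem_edgeSet, parentGraph_adj]
      rintro ⟨hne, hvw | hvw⟩
      · have hvr : v ≠ r := by rintro rfl; exact hne (hr.symm.trans hvw)
        simp only [Finset.coe_image, Set.mem_image]
        exact ⟨v, by simpa using hvr, by rw [hvw]⟩
      · have hwr : w ≠ r := by rintro rfl; exact hne (hvw.symm.trans hr)
        simp only [Finset.coe_image, Set.mem_image]
        exact ⟨w, by simpa using hwr, by rw [hvw, Sym2.eq_swap]⟩
  have h1 := Nat.card_mono (Finset.finite_toSet _) hsub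
  have h2 : ((Finset.univ.erase r).image fun v => s(v, f v)).card ≤ Fintype.card V - 1 := by
    refine Finset.card_image_le.trans ?_
    rw [Finset.card_erase_of_mem (Finset.mem_univ r), Finset.card_univ]
  have h3 : 0 < Fintype.card V := Fintype.card_pos_iff.2 ⟨r⟩
  rw [Nat.card_eq_fintype_card (α := V)]
  have h4 : Nat.card (((Finset.univ.erase r).image fun v => s(v, f v) : Finset (Sym2 V)) :
      Set (Sym2 V)) = ((Finset.univ.erase r).image fun v => s(v, f v)).card := by
    rw [Nat.card_coe_set_eq, Set.ncard_coe_finset]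
  omega

/-- Induction on the number of steps to the root. If the edge from `v` to `f v` were oriented the
other way by `g`, the induction hypothesis at `f v` would give `f (f v) = v`, a 2-cycle. -/
lemma parentGraph_injective {r : V} {f g : V → V} (hf : LeadsTo r f) (hfr : f r = r)
    (hgr : g r = r) (h : parentGraph f = parentGraph g) : f = g := by
  suffices key : ∀ k v, f^[k] v = r → f v = g v by
    funext v
    obtain ⟨k, hk⟩ := hf v
    exact key k v hk
  intro k
  induction k with
  | zero =>
    intro v hv
    have : v = r := hv
    rw [this, hfr, hgr]
  | succ k ih =>
    intro v hv
    rw [Function.iterate_succ_apply] at hv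
    by_cases hvr : v = r
    · rw [hvr, hfr, hgr]
    by_contra hne
    have hadj : (parentGraph g).Adj v (f v) :=
      h ▸ parentGraph_adj.2 ⟨(hf.ne_self hvr).symm, Or.inl rfl⟩
    obtain ⟨hvf, hg | hg⟩ := parentGraph_adj.1 hadj
    · exact hne hg.symm
    · have hfvr : f v ≠ r := by
        intro hh
        rw [hh, hgr] at hg
        exact hvr hg.symm
      exact hf.apply_apply_ne hvr hfvr ((ih _ hv).trans hg)

lemma exists_adj_dist_lt {G : SimpleGraph V} (hG : G.Connected) {r v : V} (hv : v ≠ r) :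
    ∃ w, G.Adj v w ∧ G.dist w r + 1 = G.dist v r := by
  obtain ⟨p, hp⟩ := hG.exists_walk_length_eq_dist v r
  cases p with
  | nil => exact absurd rfl hv
  | @cons _ w _ hadj q =>
    refine ⟨w, hadj, ?_⟩
    have h1 := SimpleGraph.dist_le q
    rw [SimpleGraph.Walk.length_cons] at hp
    have h2 : G.dist v r ≤ G.dist w r + 1 := by
      obtain ⟨q', hq'⟩ := hG.exists_walk_length_eq_dist w r
      rw [← hq', ← SimpleGraph.Walk.length_cons hadj q']
      exact SimpleGraph.dist_le _
    omega

/-- Parents are neighbours closer to `r`. The resulting graph is connected and contained in `T`, and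
a tree is minimal among connected graphs. -/
lemma exists_parentGraph_eq (r : V) {T : SimpleGraph V} (hT : T.IsTree) :
    ∃ f : V → V, f r = r ∧ LeadsTo r f ∧ parentGraph f = T := by
  classical
  choose g hg using fun v (hv : v ≠ r) => exists_adj_dist_lt hT.connected hv
  let f : V → V := fun v => if hv : v = r then r else g v hv
  have hfr : f r = r := by simp [f]
  have hf : ∀ v (hv : v ≠ r), f v = g v hv := fun v hv => by simp [f, hv]
  have hlead : LeadsTo r f := by
    intro v
    refine ⟨T.dist v r, ?_⟩
    generalize hk : T.dist v r = k
    induction k generalizing v with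
    | zero => exact (hT.connected.dist_eq_zero_iff).1 hk
    | succ k ih =>
      have hvr : v ≠ r := by rintro rfl; simp at hk
      rw [Function.iterate_succ_apply]
      refine ih _ ?_
      have := (hg v hvr).2
      rw [hf v hvr]
      omega
  refine ⟨f, hfr, hlead, ?_⟩
  have hle : parentGraph f ≤ T := by
    have key : ∀ v, v ≠ f v → T.Adj v (f v) := by
      intro v hv
      have hvr : v ≠ r := by rintro rfl; exact hv hfr.symm
      rw [hf v hvr]
      exact (hg v hvr).1
    intro v w hvw
    obtain ⟨hne, rfl | rfl⟩ := parentGraph_adj.1 hvw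
    · exact key _ hne
    · exact (key _ hne.symm).symm
  exact le_antisymm hle ((SimpleGraph.isTree_iff_minimal_connected.1 hT).2 hlead.connected hle)

lemma parentGraph_le_iff {r : V} {f : V → V} (hf : LeadsTo r f) (hfr : f r = r)
    {G : SimpleGraph V} : parentGraph f ≤ G ↔ ∀ v ≠ r, G.Adj v (f v) := by
  constructor
  · exact fun h v hv => h (parentGraph_adj.2 ⟨(hf.ne_self hv).symm, Or.inl rfl⟩)
  · intro h v w hvw
    obtain ⟨hne, rfl | rfl⟩ := parentGraph_adj.1 hvw
    · exact h v (by rintro rfl; exact hne hfr.symm)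
    · exact (h w (by rintro rfl; exact hne hfr)).symm

end ParentFunctions

/-! ### Hitting times of finite Markov chains -/

section HittingTimes

variable {V : Type*} [Fintype V] [DecidableEq V]

/-- The probability that the chain `P` from `x` has not met `r` up to time `t`. -/
def survival (P : V → V → ℝ) (r : V) : ℕ → V → ℝ
  | 0, x => if x = r then 0 else 1
  | t + 1, x => if x = r then 0 else ∑ y, P x y * survival P r t y

/-- The expected time at which the chain `P` from `x` meets `r`. -/
def hittingTime (P : V → V → ℝ) (r x : V) : ℝ := ∑' t, survival P r t x

variable {P : V → V → ℝ} {r : V}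

lemma survival_self (t : ℕ) : survival P r t r = 0 := by
  cases t <;> simp [survival]

lemma survival_zero_of_ne {x : V} (hx : x ≠ r) : survival P r 0 x = 1 := by simp [survival, hx]

lemma survival_succ_of_ne (t : ℕ) {x : V} (hx : x ≠ r) :
    survival P r (t + 1) x = ∑ y, P x y * survival P r t y := by simp [survival, hx]

lemma survival_nonneg (hP : ∀ x y, 0 ≤ P x y) (t : ℕ) (x : V) : 0 ≤ survival P r t x := by
  induction t generalizing x with
  | zero => simp only [survival]; split_ifs <;> norm_num
  | succ t ih =>
    simp only [survival]
    split_ifs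
    · exact le_rfl
    · exact Finset.sum_nonneg fun y _ => mul_nonneg (hP x y) (ih y)

/-- A supersolution of the hitting-time equation dominates the truncated expected hitting time, by
first-step analysis. -/
lemma sum_survival_le (hP : ∀ x y, 0 ≤ P x y) {φ : V → ℝ} (h0 : ∀ x, 0 ≤ φ x)
    (hφ : ∀ x ≠ r, 1 + ∑ y, P x y * φ y ≤ φ x) (N : ℕ) (x : V) :
    ∑ t ∈ Finset.range N, survival P r t x ≤ φ x := by
  induction N generalizing x with
  | zero => simpa using h0 x
  | succ N ih =>
    by_cases hx : x = r
    · subst hx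
      simpa [survival_self] using h0 x
    · rw [Finset.sum_range_succ', survival_zero_of_ne hx]
      simp only [survival_succ_of_ne _ hx]
      rw [Finset.sum_comm, add_comm]
      refine le_trans (add_le_add le_rfl (Finset.sum_le_sum fun y _ => ?_)) (hφ x hx)
      rw [← Finset.mul_sum]
      exact mul_le_mul_of_nonneg_left (ih y) (hP x y)

lemma summable_survival (hP : ∀ x y, 0 ≤ P x y) {φ : V → ℝ} (h0 : ∀ x, 0 ≤ φ x)
    (hφ : ∀ x ≠ r, 1 + ∑ y, P x y * φ y ≤ φ x) (x : V) :
    Summable fun t => survival P r t x :=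
  summable_of_sum_range_le (fun t => survival_nonneg hP t x)
    (fun N => sum_survival_le hP h0 hφ N x)

lemma hittingTime_self : hittingTime P r r = 0 := by simp [hittingTime, survival_self]

lemma hittingTime_nonneg (hP : ∀ x y, 0 ≤ P x y) (x : V) : 0 ≤ hittingTime P r x :=
  tsum_nonneg fun t => survival_nonneg hP t x

/-- First-step equation. Summability is needed because a divergent `tsum` has the value zero. -/
lemma hittingTime_eq (hs : ∀ x, Summable fun t => survival P r t x) {x : V} (hx : x ≠ r) :
    hittingTime P r x = 1 + ∑ y, P x y * hittingTime P r y := by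
  unfold hittingTime
  rw [(hs x).tsum_eq_zero_add, survival_zero_of_ne hx]
  simp only [survival_succ_of_ne _ hx]
  rw [Summable.tsum_finsetSum fun y _ => (hs y).mul_left _]
  simp only [tsum_mul_left]

/-- The minimum principle. -/
lemma nonneg_of_superharmonic (hP : ∀ x y, 0 ≤ P x y)
    (hs : ∀ x, Summable fun t => survival P r t x) {D : V → ℝ} (hr : 0 ≤ D r)
    (hD : ∀ x ≠ r, ∑ y, P x y * D y ≤ D x) (x : V) : 0 ≤ D x := by
  set K := ∑ y, |D y| with hK
  have hKle : ∀ y, -K ≤ D y := fun y => by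
    have := Finset.single_le_sum (f := fun y => |D y|) (fun y _ => abs_nonneg _) (Finset.mem_univ y)
    have h2 := neg_abs_le (D y)
    linarith
  -- Iterating superharmonicity up to time `t` leaves only the paths that have not met `r`, and
  -- their probability tends to zero.
  have key : ∀ t x, -K * survival P r t x ≤ D x := by
    intro t
    induction t with
    | zero =>
      intro x
      by_cases hx : x = r
      · subst hx; simpa [survival_self] using hr
      · rw [survival_zero_of_ne hx, mul_one]; exact hKle x
    | succ t ih =>
      intro x
      by_cases hx : x = r
      · subst hx; simpa [survival_self] using hr
      · rw [survival_succ_of_ne _ hx, Finset.mul_sum]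
        refine le_trans (Finset.sum_le_sum fun y _ => ?_) (hD x hx)
        rw [mul_left_comm]
        exact mul_le_mul_of_nonneg_left (ih y) (hP x y)
  have hlim := ((hs x).tendsto_atTop_zero).const_mul (-K)
  rw [mul_zero] at hlim
  exact le_of_tendsto' hlim fun t => key t x

/-- The expected return time of a reversible chain. -/
lemma return_time {w : V → ℝ} (hrev : ∀ x y, w x * P x y = w y * P y x)
    (hrow : ∀ x, ∑ y, P x y = 1) (hs : ∀ x, Summable fun t => survival P r t x) :
    w r * (1 + ∑ y, P r y * hittingTime P r y) = ∑ x, w x := by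
  set h := hittingTime P r with hh
  -- Reversibility makes `w` stationary. Off `r` the first-step equation cancels everything except
  -- `∑ w`.
  have h1 : ∑ x, w x * ∑ y, P x y * h y = ∑ y, w y * h y := by
    simp only [Finset.mul_sum]
    rw [Finset.sum_comm]
    refine Finset.sum_congr rfl fun y _ => ?_
    calc ∑ x, w x * (P x y * h y) = ∑ x, w y * h y * P y x :=
          Finset.sum_congr rfl fun x _ => by rw [← mul_assoc, hrev]; ring
      _ = _ := by rw [← Finset.mul_sum, hrow, mul_one]
  rw [← Finset.add_sum_erase _ _ (Finset.mem_univ r),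
    ← Finset.add_sum_erase _ (fun y => w y * h y) (Finset.mem_univ r)] at h1
  have h2 : ∑ x ∈ Finset.univ.erase r, w x * ∑ y, P x y * h y =
      ∑ x ∈ Finset.univ.erase r, w x * h x - ∑ x ∈ Finset.univ.erase r, w x := by
    rw [← Finset.sum_sub_distrib]
    refine Finset.sum_congr rfl fun x hx => ?_
    rw [hh, hittingTime_eq hs (Finset.ne_of_mem_erase hx)]
    ring
  have h3 : h r = 0 := hittingTime_self
  rw [← Finset.add_sum_erase _ w (Finset.mem_univ r)]
  rw [h2, h3] at h1
  linarith

/-- The function `u x = P_x(v is visited before r)` and the expected number `g` of visits to `v`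
before the chain from `v` meets `r`, given by the commute time of `v` and `r`. -/
lemma exists_escape {w : V → ℝ} (hP : ∀ x y, 0 ≤ P x y) (hw : ∀ x, 0 < w x)
    (hrev : ∀ x y, w x * P x y = w y * P y x) (hrow : ∀ x, ∑ y, P x y = 1)
    (hs : ∀ r x, Summable fun t => survival P r t x) {v : V} (hv : v ≠ r) :
    ∃ u : V → ℝ, ∃ g : ℝ, 1 ≤ g ∧
      g = w v / (∑ x, w x) * (hittingTime P r v + hittingTime P v r) ∧ (∀ x, 0 ≤ u x) ∧
      u v = 1 ∧ (∀ x ≠ r, x ≠ v → ∑ y, P x y * u y = u x) ∧ ∑ y, P v y * u y = 1 - 1 / g := by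
  set W := ∑ x, w x with hW
  have hWpos : 0 < W := Finset.sum_pos (fun x _ => hw x) ⟨v, Finset.mem_univ v⟩
  -- `D x` is the expected number of visits to `v` before `r` from `x`, written through hitting
  -- times; `g = D v` and `u = D / D v`.
  set D : V → ℝ := fun x =>
    w v / W * (hittingTime P r x + hittingTime P v r - hittingTime P v x) with hDdef
  have hPD : ∀ x, ∑ y, P x y * D y = w v / W * (∑ y, P x y * hittingTime P r y +
      hittingTime P v r - ∑ y, P x y * hittingTime P v y) := by
    intro x
    have : hittingTime P v r = ∑ y, P x y * hittingTime P v r := by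
      rw [← Finset.sum_mul, hrow, one_mul]
    rw [this, ← Finset.sum_add_distrib, ← Finset.sum_sub_distrib, Finset.mul_sum]
    refine Finset.sum_congr rfl fun y _ => ?_
    simp only [hDdef]
    ring
  have hDr : D r = 0 := by simp [hDdef, hittingTime_self]
  have hDx : ∀ x ≠ r, x ≠ v → ∑ y, P x y * D y = D x := by
    intro x hx hxv
    rw [hPD, hDdef]
    simp only
    rw [hittingTime_eq (hs r) hx, hittingTime_eq (hs v) hxv]
    ring
  -- The defect is exactly 1 because the expected return time to `v` is `W / w v`.
  have hDv : ∑ y, P v y * D y = D v - 1 := by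
    have hret := return_time hrev hrow (hs v)
    have hwv := (hw v).ne'
    rw [← hW] at hret
    rw [hPD, hDdef]
    simp only
    rw [hittingTime_eq (hs r) hv, hittingTime_self]
    have : ∑ y, P v y * hittingTime P v y = W / w v - 1 := by
      field_simp
      linarith
    rw [this]
    field_simp
    ring
  have hD0 : ∀ x, 0 ≤ D x := nonneg_of_superharmonic hP (hs r) hDr.ge fun x hx => by
    by_cases hxv : x = v
    · subst hxv; rw [hDv]; linarith
    · exact (hDx x hx hxv).le
  have hD1 : 1 ≤ D v := by
    have : 0 ≤ ∑ y, P v y * D y := Finset.sum_nonneg fun y _ => mul_nonneg (hP v y) (hD0 y)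
    linarith
  have hDpos : 0 < D v := by linarith
  have hsum : ∀ x, ∑ y, P x y * (D y / D v) = (∑ y, P x y * D y) / D v := fun x => by
    rw [Finset.sum_div]; exact Finset.sum_congr rfl fun y _ => by ring
  refine ⟨fun x => D x / D v, D v, hD1, by simp [hDdef, hittingTime_self],
    fun x => div_nonneg (hD0 x) hDpos.le, div_self hDpos.ne', fun x hx hxv => ?_, ?_⟩
  · rw [hsum, hDx x hx hxv]
  · rw [hsum, hDv]; field_simp

end HittingTimes

/-! ### The simple random walk -/

section Walk

variable {n : ℕ} (G : SimpleGraph (Fin n))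

/-- The transition probabilities of the simple random walk, as real numbers. -/
def stepProb (x y : Fin n) : ℝ := (walkStep G x y).toReal

/-- The degree of a vertex. -/
def deg (x : Fin n) : ℕ := (G.neighborSet x).ncard

lemma stepProb_nonneg (x y : Fin n) : 0 ≤ stepProb G x y := ENNReal.toReal_nonneg

lemma ofReal_stepProb (x y : Fin n) : ENNReal.ofReal (stepProb G x y) = walkStep G x y :=
  ENNReal.ofReal_toReal (PMF.apply_ne_top _ _)

lemma sum_stepProb (x : Fin n) : ∑ y, stepProb G x y = 1 := by
  unfold stepProb
  rw [← ENNReal.toReal_sum fun y _ => PMF.apply_ne_top _ _, ← tsum_fintype (L := .unconditional _),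
    PMF.tsum_coe, ENNReal.toReal_one]

open Classical in
lemma walkStep_apply_of_pos {x : Fin n} (hx : 0 < deg G x) (y : Fin n) :
    walkStep G x y = if G.Adj x y then ((deg G x : ℝ≥0∞))⁻¹ else 0 := by
  have hcard : (G.neighborFinset x).card = deg G x := by
    rw [deg, ← Set.ncard_coe_finset, SimpleGraph.coe_neighborFinset]
  have hne : (G.neighborFinset x).Nonempty := Finset.card_pos.1 (hcard ▸ hx)
  rw [walkStep, dif_pos hne, PMF.uniformOfFinset_apply, hcard]
  simp [SimpleGraph.mem_neighborFinset]

open Classical in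
lemma deg_mul_stepProb (hpos : ∀ x, 0 < deg G x) (x y : Fin n) :
    (deg G x : ℝ) * stepProb G x y = if G.Adj x y then 1 else 0 := by
  have := (Nat.cast_pos (α := ℝ)).2 (hpos x)
  rw [stepProb, walkStep_apply_of_pos G (hpos x)]
  split_ifs
  · rw [ENNReal.toReal_inv, ENNReal.toReal_natCast, mul_inv_cancel₀ this.ne']
  · simp

lemma stepProb_reversible (hpos : ∀ x, 0 < deg G x) (x y : Fin n) :
    (deg G x : ℝ) * stepProb G x y = deg G y * stepProb G y x := by
  classical
  rw [deg_mul_stepProb G hpos, deg_mul_stepProb G hpos]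
  simp [SimpleGraph.adj_comm]

lemma deg_lt [NeZero n] (x : Fin n) : deg G x < n := by
  have h : G.neighborSet x ⊆ {x}ᶜ := fun y hy => by
    have : G.Adj x y := hy
    simpa using this.ne'
  refine (Set.ncard_le_ncard h).trans_lt ?_
  rw [Set.ncard_compl]
  simp [Nat.pos_of_ne_zero (NeZero.ne n)]

variable {G}

lemma deg_pos (hG : G.Connected) (hn : 2 ≤ n) (x : Fin n) : 0 < deg G x := by
  have : Nontrivial (Fin n) := Fin.nontrivial_iff_two_le.2 hn
  obtain ⟨y, hy⟩ := hG.preconnected.exists_adj_of_nontrivial x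
  exact (Set.ncard_pos).2 ⟨y, hy⟩

lemma inv_le_stepProb (hpos : ∀ x, 0 < deg G x) {x y : Fin n} (h : G.Adj x y) :
    (n : ℝ)⁻¹ ≤ stepProb G x y := by
  classical
  have h1 := deg_mul_stepProb G hpos x y
  rw [if_pos h] at h1
  have h2 : (0 : ℝ) < deg G x := Nat.cast_pos.2 (hpos x)
  have : NeZero n := ⟨fun h0 => by subst h0; exact x.elim0⟩
  have h3 : (deg G x : ℝ) ≤ n := Nat.cast_le.2 (deg_lt G x).le
  rw [← inv_eq_of_mul_eq_one_right h1]
  exact inv_anti₀ h2 h3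

/-- The supersolution is `K (1 - A⁻¹ ^ dist)` with `A = 2 n`. Some neighbour is closer to `r` and is
chosen with probability at least `1 / n`; it alone doubles the expected value of `A⁻¹ ^ dist`. `K`
is so large that the resulting gain is at least 1. -/
lemma summable_survival_walk (hG : G.Connected) (hn : 2 ≤ n) (r x : Fin n) :
    Summable fun t => survival (stepProb G) r t x := by
  set A : ℝ := 2 * n with hA
  have hn0 : (0 : ℝ) < n := by positivity
  have hA1 : 1 ≤ A := by
    have : (2 : ℝ) ≤ n := by exact_mod_cast hn
    linarith
  have hA0 : 0 < A := by linarith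
  set K : ℝ := ∑ y, A ^ G.dist y r with hK
  have hKle : ∀ y, A ^ G.dist y r ≤ K := fun y =>
    Finset.single_le_sum (f := fun y => A ^ G.dist y r) (fun y _ => by positivity)
      (Finset.mem_univ y)
  have hK0 : 0 < K := lt_of_lt_of_le (by positivity) (hKle r)
  refine summable_survival (stepProb_nonneg G) (φ := fun y => K * (1 - A⁻¹ ^ G.dist y r))
    (fun y => ?_) (fun y hy => ?_) x
  · refine mul_nonneg hK0.le (sub_nonneg.2 (pow_le_one₀ (by positivity) ?_))
    exact inv_le_one_of_one_le₀ hA1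
  · obtain ⟨z, hadj, hz⟩ := exists_adj_dist_lt hG hy
    have h1 : ∑ w, stepProb G y w * (K * (1 - A⁻¹ ^ G.dist w r)) =
        K - K * ∑ w, stepProb G y w * A⁻¹ ^ G.dist w r := by
      have : K = K * ∑ w, stepProb G y w := by rw [sum_stepProb, mul_one]
      rw [Finset.mul_sum] at this
      conv_rhs => rw [Finset.mul_sum]
      nth_rewrite 2 [this]
      rw [← Finset.sum_sub_distrib]
      exact Finset.sum_congr rfl fun w _ => by ring
    have h2 : (n : ℝ)⁻¹ * A⁻¹ ^ G.dist z r ≤ ∑ w, stepProb G y w * A⁻¹ ^ G.dist w r := by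
      refine le_trans ?_ (Finset.single_le_sum (f := fun w => stepProb G y w * A⁻¹ ^ G.dist w r)
        (fun w _ => mul_nonneg (stepProb_nonneg G y w) (by positivity)) (Finset.mem_univ z))
      exact mul_le_mul_of_nonneg_right (inv_le_stepProb (deg_pos hG hn) hadj) (by positivity)
    have h3 : (n : ℝ)⁻¹ * A⁻¹ ^ G.dist z r = 2 * A⁻¹ ^ G.dist y r := by
      rw [← hz, pow_succ, hA]
      field_simp
    have h4 : 1 ≤ K * A⁻¹ ^ G.dist y r := by
      calc (1 : ℝ) = A ^ G.dist y r * A⁻¹ ^ G.dist y r := by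
            rw [← mul_pow, mul_inv_cancel₀ hA0.ne', one_pow]
        _ ≤ _ := mul_le_mul_of_nonneg_right (hKle y) (by positivity)
    rw [h1]
    have h5 := mul_le_mul_of_nonneg_left (h3 ▸ h2) hK0.le
    linarith

/-! ### The trajectory law, and hitting times versus the cover time -/

instance (v : Fin n) : IsProbabilityMeasure (walkLaw G v) := by
  unfold walkLaw
  infer_instance

/-- The Markov property, from the composition-product form of the joint law of the history and the
next position. -/
lemma lintegral_walkLaw_succ (v : Fin n) (t : ℕ)
    (F : ((i : Finset.Iic t) → (fun _ : ℕ => Fin n) i) → ℝ≥0∞) (f : Fin n → ℝ≥0∞) :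
    ∫⁻ ω, F (Preorder.frestrictLe t ω) * f (ω (t + 1)) ∂(walkLaw G v) =
      ∫⁻ ω, F (Preorder.frestrictLe t ω) * ∑ y, walkStep G (ω t) y * f y ∂(walkLaw G v) := by
  have h1 := Kernel.partialTraj_compProd_eq_map_traj (X := fun _ => Fin n)
    (κ := historyKernel G) (Nat.zero_le t) (x₀ := fun _ => v)
  have hF : Measurable F := measurable_of_countable F
  have hf : Measurable f := measurable_of_countable f
  have h2 : ∫⁻ ω, F (Preorder.frestrictLe t ω) * f (ω (t + 1)) ∂(walkLaw G v) =
      ∫⁻ z, F z.1 * f z.2 ∂((walkLaw G v).map fun x => (Preorder.frestrictLe t x, x (t + 1))) := by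
    rw [lintegral_map (by fun_prop) (by fun_prop)]
  have h3 : ∫⁻ ω, F (Preorder.frestrictLe t ω) * ∑ y, walkStep G (ω t) y * f y ∂(walkLaw G v) =
      ∫⁻ h, F h * ∑ y, walkStep G (h ⟨t, Finset.mem_Iic.2 le_rfl⟩) y * f y
        ∂((walkLaw G v).map (Preorder.frestrictLe t)) := by
    rw [lintegral_map (measurable_of_countable _) (by fun_prop)]
    rfl
  rw [h2, h3]
  unfold walkLaw
  rw [← h1, Measure.lintegral_compProd (by fun_prop), Kernel.traj_map_frestrictLe_apply]
  refine lintegral_congr fun h => ?_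
  change ∫⁻ b, F h * f b ∂(historyKernel G t h) = _
  rw [lintegral_const_mul (F h) hf]
  congr 1
  have : historyKernel G t h = (walkStep G (h ⟨t, Finset.mem_Iic.2 le_rfl⟩)).toMeasure := rfl
  rw [this, lintegral_fintype]
  refine Finset.sum_congr rfl fun y _ => ?_
  rw [PMF.toMeasure_apply_singleton _ _ (measurableSet_singleton y), mul_comm]

lemma ae_walkLaw_zero (v : Fin n) : ∀ᵐ ω ∂(walkLaw G v), ω 0 = v := by
  have h := Kernel.traj_map_frestrictLe_apply (X := fun _ => Fin n) (κ := historyKernel G) 0 0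
    (fun _ => v)
  rw [Kernel.partialTraj_self, Kernel.id_apply] at h
  have h2 : ∀ᵐ h ∂((walkLaw G v).map (Preorder.frestrictLe 0)),
      h ⟨0, Finset.mem_Iic.2 le_rfl⟩ = v := by
    unfold walkLaw
    rw [h, ae_dirac_eq]
    rfl
  exact ae_of_ae_map (by fun_prop) h2

-- Induction on `t` for all `s` at once: the Markov property trades one step of the trajectory for
-- one step of `survival`.
open Classical in
lemma lintegral_survival (r v : Fin n) (t s : ℕ) :
    ∫⁻ ω, (if ∀ i ≤ t, ω i ≠ r then 1 else 0) *
      ENNReal.ofReal (survival (stepProb G) r s (ω t)) ∂(walkLaw G v) =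
      ENNReal.ofReal (survival (stepProb G) r (s + t) v) := by
  induction t generalizing s with
  | zero =>
    refine (lintegral_congr_ae (g := fun _ => ENNReal.ofReal (survival (stepProb G) r s v))
      ?_).trans (by simp)
    filter_upwards [ae_walkLaw_zero v] with ω hω
    by_cases hv : v = r
    · simp [hω, hv, survival_self]
    · simp [hω, hv]
  | succ t ih =>
    rw [show s + (t + 1) = (s + 1) + t by ring, ← ih (s + 1)]
    have h1 := lintegral_walkLaw_succ (G := G) v t
      (fun h => if ∀ i, h i ≠ r then 1 else 0)
      (fun y => ENNReal.ofReal (survival (stepProb G) r s y))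
    have hiff : ∀ ω : ℕ → Fin n,
        (∀ i, Preorder.frestrictLe (π := fun _ => Fin n) t ω i ≠ r) ↔ ∀ i ≤ t, ω i ≠ r := by
      intro ω
      simp [Preorder.frestrictLe_apply]
    simp only [hiff] at h1
    refine Eq.trans ?_ (h1.trans ?_)
    · refine lintegral_congr fun ω => ?_
      by_cases hr : ω (t + 1) = r
      · simp [hr, survival_self]
      · congr 2
        refine propext ⟨fun h i hi => h i (by omega), fun h i hi => ?_⟩
        rcases Nat.le_succ_iff.1 hi with h' | h'
        · exact h i h'
        · exact h' ▸ hr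
    · refine lintegral_congr fun ω => ?_
      by_cases hr : ∀ i ≤ t, ω i ≠ r
      · congr 1
        rw [survival_succ_of_ne _ (hr t le_rfl), ENNReal.ofReal_sum_of_nonneg fun y _ =>
          mul_nonneg (stepProb_nonneg G _ _) (survival_nonneg (stepProb_nonneg G) _ _)]
        refine Finset.sum_congr rfl fun y _ => ?_
        rw [ENNReal.ofReal_mul (stepProb_nonneg G _ _), ofReal_stepProb]
      · simp [hr]

open Classical in
lemma lintegral_not_visited (r v : Fin n) (t : ℕ) :
    ∫⁻ ω, (if ∀ i ≤ t, ω i ≠ r then 1 else 0) ∂(walkLaw G v) =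
      ENNReal.ofReal (survival (stepProb G) r t v) := by
  have h := lintegral_survival (G := G) r v t 0
  rw [zero_add] at h
  rw [← h]
  refine lintegral_congr fun ω => ?_
  by_cases hr : ∀ i ≤ t, ω i ≠ r
  · rw [survival_zero_of_ne (hr t le_rfl)]
    simp
  · simp [hr]

open Classical in
lemma sum_not_visited_le_timeToCover (r : Fin n) (ω : ℕ → Fin n) (N : ℕ) :
    ∑ t ∈ Finset.range N, (if ∀ i ≤ t, ω i ≠ r then (1 : ℝ≥0∞) else 0) ≤ timeToCover ω := by
  refine le_iInf₂ fun t₀ ht₀ => ?_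
  obtain ⟨s, hs, hsr⟩ := ht₀ r
  calc ∑ t ∈ Finset.range N, (if ∀ i ≤ t, ω i ≠ r then (1 : ℝ≥0∞) else 0)
      ≤ ∑ t ∈ Finset.range N, if t < s then (1 : ℝ≥0∞) else 0 := by
        refine Finset.sum_le_sum fun t _ => ?_
        by_cases hts : t < s
        · simp only [hts, if_true]
          split_ifs <;> simp
        · rw [if_neg (fun h => h s (not_lt.1 hts) hsr)]
          simp
    _ = ((Finset.range N).filter fun t => t < s).card := by simp
    _ ≤ ((Finset.range s).card : ℝ≥0∞) := by
        refine Nat.cast_le.2 (Finset.card_le_card fun t ht => ?_)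
        simpa using (Finset.mem_filter.1 ht).2
    _ ≤ t₀ := by simpa using hs

/-- A trajectory meets `r` no later than it covers the graph; summing tail probabilities compares
the expectations. -/
lemma hittingTime_le_coverTime {τ : ℝ≥0} (hτ : coverTime G = τ) (r v : Fin n) :
    hittingTime (stepProb G) r v ≤ τ := by
  classical
  refine Real.tsum_le_of_sum_range_le (fun t => survival_nonneg (stepProb_nonneg G) t v) fun N => ?_
  have hN : ∑ t ∈ Finset.range N, ENNReal.ofReal (survival (stepProb G) r t v) ≤ τ := by
    simp only [← lintegral_not_visited]
    rw [← lintegral_finsetSum, ← hτ]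
    · refine (lintegral_mono fun ω => sum_not_visited_le_timeToCover r ω N).trans ?_
      exact le_iSup (fun v => ∫⁻ ω, timeToCover ω ∂(walkLaw G v)) v
    · intro t _
      refine Measurable.ite ?_ measurable_const measurable_const
      have : {ω : ℕ → Fin n | ∀ i ≤ t, ω i ≠ r} = ⋂ i ∈ Set.Iic t, {ω | ω i ≠ r} := by
        ext ω; simp
      rw [this]
      refine MeasurableSet.biInter (Set.to_countable _) fun i _ => ?_
      exact (measurableSet_singleton r).compl.preimage (measurable_pi_apply i)
  rw [← ENNReal.ofReal_sum_of_nonneg fun t _ => survival_nonneg (stepProb_nonneg G) t v] at hN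
  have := ENNReal.toReal_mono ENNReal.coe_ne_top hN
  rwa [ENNReal.toReal_ofReal (Finset.sum_nonneg fun t _ =>
    survival_nonneg (stepProb_nonneg G) t v), ENNReal.coe_toReal] at this

/-- By time `t` at most `t + 1` vertices are seen. This bound on `τ / n` from below later absorbs
the additive round. -/
lemma le_coverTime (v : Fin n) : ((n - 1 : ℕ) : ℝ≥0∞) ≤ coverTime G := by
  refine le_trans ?_ (le_iSup (fun v => ∫⁻ ω, timeToCover ω ∂(walkLaw G v)) v)
  have h : ∀ ω : ℕ → Fin n, ((n - 1 : ℕ) : ℝ≥0∞) ≤ timeToCover ω := by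
    intro ω
    refine le_iInf₂ fun t ht => Nat.cast_le.2 ?_
    have hsub : (Finset.univ : Finset (Fin n)) ⊆ (Finset.range (t + 1)).image ω := by
      intro u _
      obtain ⟨s, hs, hu⟩ := ht u
      exact Finset.mem_image.2 ⟨s, Finset.mem_range.2 (by omega), hu⟩
    have := (Finset.card_le_card hsub).trans Finset.card_image_le
    simp only [Finset.card_univ, Fintype.card_fin, Finset.card_range] at this
    omega
  calc ((n - 1 : ℕ) : ℝ≥0∞) = ∫⁻ _, ((n - 1 : ℕ) : ℝ≥0∞) ∂(walkLaw G v) := by simp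
    _ ≤ _ := lintegral_mono h

end Walk

/-! ### Random stacks -/

section RandomStacks

variable {n : ℕ} (G : SimpleGraph (Fin n))

/-- The law of independent stacks of steps of the simple random walk. -/
def stackLaw : Measure (Fin n × ℕ → Fin n) :=
  Measure.infinitePi fun i => (walkStep G i.1).toMeasure

instance : IsProbabilityMeasure (stackLaw G) := by
  unfold stackLaw
  infer_instance

lemma measurable_pushTop (x a : Fin n) : Measurable (pushTop x a) := by
  refine measurable_pi_lambda _ fun i => ?_
  unfold pushTop
  split_ifs <;> fun_prop

lemma measurable_dropTop (x : Fin n) : Measurable (dropTop x) := by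
  refine measurable_pi_lambda _ fun i => ?_
  unfold dropTop
  split_ifs <;> fun_prop

/-- The top arrow of `x` is independent of the rest, and the stacks left after its removal have the
original law. This is the Markov property of the walk that consumes arrows. -/
lemma stackLaw_eq_sum_pushTop (x : Fin n) :
    stackLaw G = ∑ a, walkStep G x a • (stackLaw G).map (pushTop x a) := by
  classical
  symm
  refine Measure.eq_infinitePi _ fun s t ht => ?_
  set m : Fin n × ℕ → Measure (Fin n) := fun i => (walkStep G i.1).toMeasure with hm
  -- Shifts the stack of `x` down by one position; only `(x, 0)` is missed.
  let lift : Fin n × ℕ → Fin n × ℕ := fun j => if j.1 = x then (j.1, j.2 + 1) else j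
  have hfst : ∀ j, (lift j).1 = j.1 := fun j => by simp only [lift]; split_ifs <;> rfl
  have hinj : Function.Injective lift := by
    rintro ⟨y, k⟩ ⟨z, l⟩ h
    have h1 := hfst (y, k)
    rw [h, hfst] at h1
    simp only at h1
    subst h1
    by_cases hz : z = x <;> simp_all [lift]
  have hrange : ∀ i, i ∉ Set.range lift ↔ i = (x, 0) := by
    rintro ⟨y, k⟩
    constructor
    · intro h
      by_cases hy : y = x
      · subst hy
        cases k with
        | zero => rfl
        | succ k => exact absurd ⟨(y, k), by simp [lift]⟩ h
      · exact absurd ⟨(y, k), by simp [lift, hy]⟩ h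
    · rintro h ⟨⟨z, l⟩, hz⟩
      rw [h] at hz
      have h1 := hfst (z, l)
      rw [hz] at h1
      simp only at h1
      subst h1
      simp [lift] at hz
  have hpush : ∀ a ω j, pushTop x a ω (lift j) = ω j := by
    rintro a ω ⟨y, k⟩
    by_cases hy : y = x <;> simp [pushTop, lift, hy]
  have hpre : ∀ a, pushTop x a ⁻¹' (Set.pi s t) =
      if (x, 0) ∈ s → a ∈ t (x, 0) then
        Set.pi (s.preimage lift hinj.injOn : Finset _) (fun j => t (lift j)) else ∅ := by
    intro a
    ext ω
    split_ifs with ha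
    · simp only [Set.mem_preimage, Set.mem_pi, Finset.mem_coe, Finset.mem_preimage]
      constructor
      · intro h j hj
        rw [← hpush a ω j]
        exact h _ hj
      · intro h i hi
        by_cases hir : i ∈ Set.range lift
        · obtain ⟨j, rfl⟩ := hir
          rw [hpush]
          exact h j hi
        · rw [(hrange i).1 hir, pushTop_top]
          exact ha ((hrange i).1 hir ▸ hi)
    · push Not at ha
      simp only [Set.mem_preimage, Set.mem_pi, Finset.mem_coe, Set.mem_empty_iff_false, iff_false]
      intro h
      have := h _ ha.1
      rw [pushTop_top] at this
      exact ha.2 this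
  have hmass : stackLaw G (Set.pi (s.preimage lift hinj.injOn : Finset _) (fun j => t (lift j))) =
      ∏ i ∈ s with i ∈ Set.range lift, m i (t i) := by
    rw [stackLaw, Measure.infinitePi_pi _ fun i _ => ht _]
    rw [← Finset.prod_preimage' lift s hinj.injOn fun i => m i (t i)]
    refine Finset.prod_congr rfl fun j _ => ?_
    simp only [hm, hfst]
  have hmeas : MeasurableSet (Set.pi (s : Set (Fin n × ℕ)) t) :=
    MeasurableSet.pi s.countable_toSet fun i _ => ht i
  have hnot : ∏ i ∈ s with i ∉ Set.range lift, m i (t i) =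
      ∑ a, walkStep G x a * if (x, 0) ∈ s → a ∈ t (x, 0) then 1 else 0 := by
    simp only [hrange]
    rw [Finset.filter_eq']
    by_cases hx : (x, 0) ∈ s
    · simp only [hx, if_true, Finset.prod_singleton, hm, forall_const]
      rw [PMF.toMeasure_apply_fintype]
      refine Finset.sum_congr rfl fun a _ => ?_
      by_cases ha : a ∈ t (x, 0) <;> simp [ha]
    · simp only [hx, if_false, Finset.prod_empty, false_imp_iff, if_true, mul_one]
      rw [← tsum_fintype (L := .unconditional _), PMF.tsum_coe]
  rw [Measure.finsetSum_apply, ← Finset.prod_filter_mul_prod_filter_not s (· ∈ Set.range lift),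
    hnot, Finset.mul_sum]
  refine Finset.sum_congr rfl fun a _ => ?_
  rw [Measure.smul_apply, Measure.map_apply (measurable_pushTop x a) hmeas, hpre, smul_eq_mul]
  split_ifs
  · rw [hmass]; ring
  · simp

lemma stackLaw_apply_eq_sum (x : Fin n) {E : Set (Fin n × ℕ → Fin n)} (hE : MeasurableSet E) :
    stackLaw G E = ∑ a, walkStep G x a * stackLaw G {ω | pushTop x a ω ∈ E} := by
  conv_lhs => rw [stackLaw_eq_sum_pushTop G x]
  rw [Measure.finsetSum_apply]
  refine Finset.sum_congr rfl fun a _ => ?_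
  rw [Measure.smul_apply, Measure.map_apply (measurable_pushTop x a) hE, smul_eq_mul]
  rfl

lemma hits_succ_of_ne {r v : Fin n} {t : ℕ} {x : Fin n} {k : ℕ} {ω : Fin n × ℕ → Fin n}
    (hx : x ≠ r) (hxv : x ≠ v) :
    Hits r v (t + 1) x k ω ↔ Hits r v t (ω (x, 0)) k (dropTop x ω) := by
  simp [Hits, hx, hxv]

lemma hits_succ_self {r v : Fin n} {t : ℕ} {k : ℕ} {ω : Fin n × ℕ → Fin n} (hv : v ≠ r) :
    Hits r v (t + 1) v (k + 1) ω ↔ Hits r v t (ω (v, 0)) k (dropTop v ω) := by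
  simp [Hits, hv]

lemma measurableSet_hits (r v : Fin n) (t : ℕ) (x : Fin n) (k : ℕ) :
    MeasurableSet {ω | Hits r v t x k ω} := by
  induction t generalizing x k with
  | zero => exact MeasurableSet.const _
  | succ t ih =>
    by_cases hx : x = r
    · simp [Hits, hx]
    have key : ∀ j, MeasurableSet {ω | Hits r v t (ω (x, 0)) j (dropTop x ω)} := by
      intro j
      have : {ω | Hits r v t (ω (x, 0)) j (dropTop x ω)} =
          ⋃ y, {ω | ω (x, 0) = y} ∩ dropTop x ⁻¹' {ω | Hits r v t y j ω} := by
        ext ω; simp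
      rw [this]
      refine MeasurableSet.iUnion fun y => ?_
      exact ((measurableSet_singleton y).preimage (measurable_pi_apply (x, 0))).inter
        (measurable_dropTop x (ih y j))
    by_cases hxv : x = v
    · subst hxv
      cases k with
      | zero => simp [Hits, hx]
      | succ k => simp only [hits_succ_self hx]; exact key k
    · simp only [hits_succ_of_ne hx hxv]
      exact key k

/-- The probability that the walk from `x` does not reach `r` within `t` steps and `k` departures
from `v`. -/
lemma stackLaw_not_hits_le {r v : Fin n} {u : Fin n → ℝ} {q : ℝ} (hq : 0 ≤ q)
    (hu : ∀ x, 0 ≤ u x) (huv : u v = 1)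
    (hux : ∀ x ≠ r, x ≠ v → ∑ y, stepProb G x y * u y = u x)
    (huq : ∑ y, stepProb G v y * u y = q) (t : ℕ) (x : Fin n) (k : ℕ) :
    stackLaw G {ω | ¬ Hits r v t x k ω} ≤
      ENNReal.ofReal (u x * q ^ k + survival (stepProb G) r t x) := by
  have hs : ∀ t x, 0 ≤ survival (stepProb G) r t x := survival_nonneg (stepProb_nonneg G)
  induction t generalizing x k with
  | zero =>
    by_cases hx : x = r
    · simp [Hits, hx]
    · refine prob_le_one.trans ?_
      rw [survival_zero_of_ne hx, ENNReal.one_le_ofReal]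
      have := mul_nonneg (hu x) (pow_nonneg hq k)
      linarith
  | succ t ih =>
    by_cases hx : x = r
    · simp [Hits, hx]
    -- Conditioning on the first arrow. Exhausting `k` departures means visiting `v` (probability `u
    -- x`) and returning `k` times (probability `q` each); the survival term pays for the time
    -- limit.
    have step : ∀ j, (∀ a ω, Hits r v (t + 1) x k (pushTop x a ω) ↔ Hits r v t a j ω) →
        stackLaw G {ω | ¬ Hits r v (t + 1) x k ω} ≤
          ENNReal.ofReal ((∑ y, stepProb G x y * u y) * q ^ j +
            survival (stepProb G) r (t + 1) x) := by
      intro j hj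
      rw [stackLaw_apply_eq_sum G x (E := {ω | ¬ Hits r v (t + 1) x k ω})
        (measurableSet_hits r v (t + 1) x k).compl]
      have : (∑ y, stepProb G x y * u y) * q ^ j + survival (stepProb G) r (t + 1) x =
          ∑ y, stepProb G x y * (u y * q ^ j + survival (stepProb G) r t y) := by
        rw [survival_succ_of_ne _ hx, Finset.sum_mul, ← Finset.sum_add_distrib]
        exact Finset.sum_congr rfl fun y _ => by ring
      rw [this, ENNReal.ofReal_sum_of_nonneg fun y _ => mul_nonneg (stepProb_nonneg G _ _)
        (add_nonneg (mul_nonneg (hu y) (pow_nonneg hq j)) (hs t y))]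
      refine Finset.sum_le_sum fun y _ => ?_
      rw [ENNReal.ofReal_mul (stepProb_nonneg G _ _), ofReal_stepProb]
      refine mul_le_mul' le_rfl ?_
      simp only [Set.mem_ofPred_eq, hj]
      exact ih y j
    by_cases hxv : x = v
    · subst hxv
      cases k with
      | zero =>
        refine prob_le_one.trans ?_
        rw [huv, ENNReal.one_le_ofReal]
        have := hs (t + 1) x
        simp only [pow_zero]
        linarith
      | succ k =>
        refine (step k fun a ω => ?_).trans_eq ?_
        · rw [hits_succ_self hx, pushTop_top, dropTop_pushTop]
        · rw [huq, huv, pow_succ]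
          ring_nf
    · refine (step k fun a ω => ?_).trans_eq ?_
      · rw [hits_succ_of_ne hx hxv, pushTop_top, dropTop_pushTop]
      · rw [hux x hx hxv]

variable {G}

/-- The walk from `v` returns to `v` a geometric number of times; the mean is at most the commute
time between `v` and the root times the stationary probability of `v`. -/
lemma stackLaw_forall_not_hits_le (hG : G.Connected) (hn : 2 ≤ n) {r v : Fin n} (hv : v ≠ r) :
    ∃ g : ℝ, 1 ≤ g ∧ g = deg G v / (∑ x, (deg G x : ℝ)) *
      (hittingTime (stepProb G) r v + hittingTime (stepProb G) v r) ∧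
      ∀ k : ℕ, stackLaw G {ω | ∀ t, ¬ Hits r v t v k ω} ≤
        ENNReal.ofReal (Real.exp (-(k / g))) := by
  have hpos := deg_pos hG hn
  obtain ⟨u, g, hg1, hg, hu0, huv, hux, huq⟩ := exists_escape (stepProb_nonneg G)
    (fun x => Nat.cast_pos.2 (hpos x)) (stepProb_reversible G hpos) (sum_stepProb G)
    (summable_survival_walk hG hn) hv
  refine ⟨g, hg1, hg, fun k => ?_⟩
  have hg0 : 0 < g := by linarith
  have hq : 0 ≤ 1 - 1 / g := sub_nonneg.2 (div_le_one_of_le₀ hg1 hg0.le)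
  have hle : ∀ t, stackLaw G {ω | ∀ t, ¬ Hits r v t v k ω} ≤
      ENNReal.ofReal ((1 - 1 / g) ^ k + survival (stepProb G) r t v) := by
    intro t
    have hsub : {ω | ∀ t, ¬ Hits r v t v k ω} ⊆ {ω | ¬ Hits r v t v k ω} := fun ω hω => hω t
    refine (measure_mono hsub).trans
      ((stackLaw_not_hits_le G hq hu0 huv hux huq t v k).trans_eq ?_)
    rw [huv, one_mul]
  -- Letting the time limit tend to infinity removes the survival term.
  have hlim : Filter.Tendsto (fun t => ENNReal.ofReal ((1 - 1 / g) ^ k +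
      survival (stepProb G) r t v)) Filter.atTop (nhds (ENNReal.ofReal ((1 - 1 / g) ^ k))) := by
    refine ENNReal.tendsto_ofReal ?_
    simpa using ((summable_survival_walk hG hn r v).tendsto_atTop_zero).const_add ((1 - 1 / g) ^ k)
  refine (ge_of_tendsto' hlim hle).trans (ENNReal.ofReal_le_ofReal ?_)
  calc (1 - 1 / g) ^ k ≤ Real.exp (-(1 / g)) ^ k :=
        pow_le_pow_left₀ hq (by linarith [Real.add_one_le_exp (-(1 / g))]) k
    _ = _ := by rw [← Real.exp_nat_mul]; congr 1; ring

end RandomStacks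

/-! ### The tree found by cycle popping is uniform -/

section Uniform

variable {n : ℕ}

/-- Cycle popping that uses only the first `l v` arrows of each vertex `v` ends with the arrows `f`
to the root. -/
def Resolves (r : Fin n) (l : Fin n → ℕ) (ω : Fin n × ℕ → Fin n) (f : Fin n → Fin n) : Prop :=
  LeadsTo r f ∧ ∃ d, Balanced r ω d ∧ tops r ω d = f ∧ ∀ v ≠ r, d v < l v

lemma Resolves.apply_root {r : Fin n} {l : Fin n → ℕ} {ω : Fin n × ℕ → Fin n}
    {f : Fin n → Fin n} (h : Resolves r l ω f) : f r = r := by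
  obtain ⟨-, d, -, rfl, -⟩ := h
  simp [tops]

lemma Resolves.unique {r : Fin n} {l l' : Fin n → ℕ} {ω : Fin n × ℕ → Fin n}
    {f f' : Fin n → Fin n} (h : Resolves r l ω f) (h' : Resolves r l' ω f') : f = f' := by
  obtain ⟨hf, d, hd, rfl, -⟩ := h
  obtain ⟨hf', d', hd', rfl, -⟩ := h'
  rw [hd.unique hd' hf hf']

/-- The strict inequality `d v < l v` matters: the visible arrow at depth `d v` is read as well. -/
lemma Resolves.congr {r : Fin n} {l : Fin n → ℕ} {ω ω' : Fin n × ℕ → Fin n}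
    {f : Fin n → Fin n} (hω : ∀ v, ∀ k < l v, ω (v, k) = ω' (v, k)) (h : Resolves r l ω f) :
    Resolves r l ω' f := by
  obtain ⟨hf, d, hd, rfl, hdl⟩ := h
  refine ⟨hf, d, hd.congr fun v k hk => ?_, ?_, hdl⟩
  · by_cases hv : v = r
    · subst hv; rw [hd.1] at hk; omega
    · exact hω v k (hk.trans (hdl v hv))
  · funext v
    by_cases hv : v = r
    · simp [tops, hv]
    · simp [tops, hv, hω v _ (hdl v hv)]

lemma Resolves.mono {r : Fin n} {l l' : Fin n → ℕ} {ω : Fin n × ℕ → Fin n}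
    {f : Fin n → Fin n} (hl : l ≤ l') (h : Resolves r l ω f) : Resolves r l' ω f := by
  obtain ⟨hf, d, hd, hdf, hdl⟩ := h
  exact ⟨hf, d, hd, hdf, fun v hv => (hdl v hv).trans_le (hl v)⟩

variable (G : SimpleGraph (Fin n))

lemma measurableSet_balanced (r : Fin n) (d : Fin n → ℕ) :
    MeasurableSet {ω | Balanced r ω d} := by
  have hm : ∀ x, Measurable fun ω : Fin n × ℕ → Fin n => indegree ω d x := by
    intro x
    unfold indegree
    simp only [Finset.card_filter]
    refine Finset.measurable_sum _ fun y _ => Finset.measurable_sum _ fun k _ => ?_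
    refine Measurable.ite ?_ measurable_const measurable_const
    exact (measurableSet_singleton x).preimage (measurable_pi_apply (y, k))
  have : {ω : Fin n × ℕ → Fin n | Balanced r ω d} =
      {ω | d r = 0} ∩ ⋂ x, {ω | indegree ω d x = d x} := by
    ext ω; simp [Balanced]
  rw [this]
  exact (MeasurableSet.const _).inter
    (MeasurableSet.iInter fun x => (hm x) (measurableSet_singleton (d x)))

lemma measurableSet_tops (r : Fin n) (d : Fin n → ℕ) (f : Fin n → Fin n) :
    MeasurableSet {ω | tops r ω d = f} := by
  have : Measurable fun ω : Fin n × ℕ → Fin n => tops r ω d := by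
    refine measurable_pi_lambda _ fun v => ?_
    unfold tops
    split_ifs <;> fun_prop
  exact this (measurableSet_singleton f)

lemma stackLaw_tops (r : Fin n) (d : Fin n → ℕ) {f : Fin n → Fin n} (hf : f r = r) :
    stackLaw G {ω | tops r ω d = f} = ∏ v ∈ Finset.univ.erase r, walkStep G v (f v) := by
  have : {ω : Fin n × ℕ → Fin n | tops r ω d = f} =
      Set.pi ((Finset.univ.erase r).image fun v => (v, d v) : Finset (Fin n × ℕ))
        fun i => {f i.1} := by
    ext ω
    simp only [Set.mem_pi, Finset.coe_image, Set.mem_image, Finset.mem_coe, Finset.mem_erase,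
      Finset.mem_univ, and_true, Set.mem_singleton_iff, forall_exists_index, and_imp]
    constructor
    · rintro h _ v hv rfl
      have := congrFun h v
      simpa [tops, hv] using this
    · intro h
      funext v
      by_cases hv : v = r
      · simp [tops, hv, hf]
      · simpa [tops, hv] using h _ v hv rfl
  rw [this, stackLaw, Measure.infinitePi_pi _ fun i _ => measurableSet_singleton _,
    Finset.prod_image fun v _ w _ h => (Prod.ext_iff.1 h).1]
  refine Finset.prod_congr rfl fun v _ => ?_
  rw [PMF.toMeasure_apply_singleton _ _ (measurableSet_singleton _)]

/-- Whether the arrows above the depths `d` are balanced does not depend on the arrows at `d`. -/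
lemma stackLaw_balanced_inter_tops (r : Fin n) (d : Fin n → ℕ) {f : Fin n → Fin n}
    (hf : f r = r) :
    stackLaw G ({ω | Balanced r ω d} ∩ {ω | tops r ω d = f}) =
      stackLaw G {ω | Balanced r ω d} * ∏ v ∈ Finset.univ.erase r, walkStep G v (f v) := by
  classical
  rw [← stackLaw_tops G r d hf]
  -- `S` holds the positions above `d` and `T` those at `d`. They are disjoint, and each event reads
  -- only one of them.
  let S : Finset (Fin n × ℕ) :=
    Finset.univ.biUnion fun v => (Finset.range (d v)).image fun k => (v, k)
  let T : Finset (Fin n × ℕ) := Finset.univ.image fun v => (v, d v)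
  have hS : ∀ v k, (v, k) ∈ S ↔ k < d v := by
    intro v k
    simp [S]
  have hT : ∀ v k, (v, k) ∈ T ↔ k = d v := by
    intro v k
    simp [T, eq_comm]
  have hST : Disjoint S T := by
    rw [Finset.disjoint_left]
    rintro ⟨v, k⟩ h1 h2
    rw [hS] at h1
    rw [hT] at h2
    omega
  have hind : IndepFun (fun (ω : Fin n × ℕ → Fin n) (i : S) => ω i)
      (fun (ω : Fin n × ℕ → Fin n) (i : T) => ω i) (stackLaw G) :=
    (iIndepFun_infinitePi (P := fun i : Fin n × ℕ => (walkStep G i.1).toMeasure)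
      (X := fun _ x => x) fun _ => measurable_id).indepFun_finset S T hST
      fun i => measurable_pi_apply i
  -- The value `r` outside `U` is a dummy that is never read.
  let ext : (U : Finset (Fin n × ℕ)) → (U → Fin n) → Fin n × ℕ → Fin n :=
    fun U g i => if h : i ∈ U then g ⟨i, h⟩ else r
  have hbal : {ω : Fin n × ℕ → Fin n | Balanced r ω d} =
      (fun (ω : Fin n × ℕ → Fin n) (i : S) => ω i) ⁻¹' {g | Balanced r (ext S g) d} := by
    ext ω
    have h : ∀ v, ∀ k < d v, ω (v, k) = ext S (fun i : S => ω i) (v, k) := fun v k hk => by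
      simp [ext, (hS v k).2 hk]
    exact ⟨fun hω => Balanced.congr h hω, fun hω => Balanced.congr (fun v k hk => (h v k hk).symm) hω⟩
  have htop : {ω : Fin n × ℕ → Fin n | tops r ω d = f} =
      (fun (ω : Fin n × ℕ → Fin n) (i : T) => ω i) ⁻¹' {g | tops r (ext T g) d = f} := by
    ext ω
    have h : tops r ω d = tops r (ext T (fun i : T => ω i)) d := by
      funext v
      simp [tops, ext, (hT v (d v)).2 rfl]
    simp only [Set.mem_preimage, Set.mem_ofPred_eq, h]
  rw [hbal, htop]
  exact hind.measure_inter_preimage_eq_mul _ _ (Set.to_countable _).measurableSet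
    (Set.to_countable _).measurableSet

lemma measurableSet_resolves (r : Fin n) (l : Fin n → ℕ) (f : Fin n → Fin n) :
    MeasurableSet {ω | Resolves r l ω f} := by
  have : {ω | Resolves r l ω f} = ⋃ d : Fin n → ℕ,
      {ω | LeadsTo r f ∧ ∀ v ≠ r, d v < l v} ∩ ({ω | Balanced r ω d} ∩ {ω | tops r ω d = f}) := by
    ext ω
    simp only [Resolves, Set.mem_ofPred_eq, Set.mem_iUnion, Set.mem_inter_iff]
    exact ⟨fun ⟨h, d, h1, h2, h3⟩ => ⟨d, ⟨h, h3⟩, h1, h2⟩,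
      fun ⟨d, ⟨h, h3⟩, h1, h2⟩ => ⟨h, d, h1, h2, h3⟩⟩
  rw [this]
  exact MeasurableSet.iUnion fun d => (MeasurableSet.const _).inter
    ((measurableSet_balanced r d).inter (measurableSet_tops r d f))

/-- The probability that popping ends with the arrows `f` is proportional to their weight. -/
lemma exists_stackLaw_resolves (r : Fin n) (l : Fin n → ℕ) : ∃ κ : ℝ≥0∞,
    ∀ f : Fin n → Fin n, f r = r → LeadsTo r f →
      stackLaw G {ω | Resolves r l ω f} =
        κ * ∏ v ∈ Finset.univ.erase r, walkStep G v (f v) := by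
  classical
  -- `κ` is the sum of the probabilities of being balanced over all admissible depths, without
  -- reference to `f`. For a given `f` the events are disjoint by uniqueness of the final depths.
  refine ⟨∑' d : {d : Fin n → ℕ // ∀ v ≠ r, d v < l v}, stackLaw G {ω | Balanced r ω d.1},
    fun f hf hlead => ?_⟩
  have : {ω | Resolves r l ω f} = ⋃ d : {d : Fin n → ℕ // ∀ v ≠ r, d v < l v},
      {ω | Balanced r ω d.1} ∩ {ω | tops r ω d.1 = f} := by
    ext ω
    simp only [Resolves, Set.mem_ofPred_eq, Set.mem_iUnion, Set.mem_inter_iff]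
    exact ⟨fun ⟨_, d, h1, h2, h3⟩ => ⟨⟨d, h3⟩, h1, h2⟩,
      fun ⟨d, h1, h2⟩ => ⟨hlead, d.1, h1, h2, d.2⟩⟩
  rw [this, measure_iUnion, ← ENNReal.tsum_mul_right]
  · exact tsum_congr fun d => stackLaw_balanced_inter_tops G r d.1 hf
  · intro d e hde
    rw [Function.onFun, Set.disjoint_left]
    rintro ω ⟨h1, h2⟩ ⟨h3, h4⟩
    simp only [Set.mem_ofPred_eq] at h1 h2 h3 h4
    exact hde (Subtype.ext (Balanced.unique h1 h3 (h2 ▸ hlead) (h4 ▸ hlead)))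
  · exact fun d => (measurableSet_balanced r d.1).inter (measurableSet_tops r d.1 f)

variable {G}

-- All spanning trees have the same weight, because each non-root vertex contributes exactly one
-- arrow.
open Classical in
lemma prod_walkStep {r : Fin n} (hpos : ∀ x ≠ r, 0 < deg G x) {f : Fin n → Fin n}
    (hf : LeadsTo r f) (hfr : f r = r) :
    ∏ v ∈ Finset.univ.erase r, walkStep G v (f v) =
      if parentGraph f ≤ G then ∏ v ∈ Finset.univ.erase r, (deg G v : ℝ≥0∞)⁻¹ else 0 := by
  split_ifs with h
  · rw [parentGraph_le_iff hf hfr] at h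
    refine Finset.prod_congr rfl fun v hv => ?_
    have hvr := Finset.ne_of_mem_erase hv
    rw [walkStep_apply_of_pos G (hpos v hvr), if_pos (h v hvr)]
  · rw [parentGraph_le_iff hf hfr] at h
    push Not at h
    obtain ⟨v, hv, hadj⟩ := h
    refine Finset.prod_eq_zero (Finset.mem_erase.2 ⟨hv, Finset.mem_univ v⟩) ?_
    rw [walkStep_apply_of_pos G (hpos v hv), if_neg hadj]

lemma bijOn_parentGraph (r : Fin n) : Set.BijOn parentGraph
    {f : Fin n → Fin n | f r = r ∧ LeadsTo r f ∧ parentGraph f ≤ G} (spanningTrees G) := by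
  refine ⟨fun f hf => ⟨hf.2.2, hf.2.1.isTree hf.1⟩, fun f hf g hg h => ?_, fun T hT => ?_⟩
  · exact parentGraph_injective hf.2.1 hf.1 hg.1 h
  · obtain ⟨f, hfr, hf, rfl⟩ := exists_parentGraph_eq r hT.2
    exact ⟨f, ⟨hfr, hf, hT.1⟩, rfl⟩

/-- The tree found by popping is uniform: each spanning tree has the same share of the probability
that popping ends. -/
lemma stackLaw_resolves_tree {r : Fin n} (hpos : ∀ x ≠ r, 0 < deg G x) (l : Fin n → ℕ)
    {T : SimpleGraph (Fin n)} (hT : T ∈ spanningTrees G) :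
    stackLaw G {ω | ∃ f, Resolves r l ω f ∧ parentGraph f = T} =
      ((spanningTrees G).ncard : ℝ≥0∞)⁻¹ * stackLaw G {ω | ∃ f, Resolves r l ω f} := by
  classical
  obtain ⟨κ, hκ⟩ := exists_stackLaw_resolves G r l
  set c : ℝ≥0∞ := ∏ v ∈ Finset.univ.erase r, (deg G v : ℝ≥0∞)⁻¹ with hc
  have hval : ∀ f : Fin n → Fin n, f r = r → LeadsTo r f →
      stackLaw G {ω | Resolves r l ω f} = if parentGraph f ≤ G then κ * c else 0 := by
    intro f hfr hf
    rw [hκ f hfr hf, prod_walkStep hpos hf hfr]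
    rw [mul_ite, mul_zero]
  obtain ⟨f₀, ⟨hf₀r, hf₀, hf₀G⟩, hf₀T⟩ := (bijOn_parentGraph r).surjOn hT
  have h1 : {ω | ∃ f, Resolves r l ω f ∧ parentGraph f = T} = {ω | Resolves r l ω f₀} := by
    ext ω
    constructor
    · rintro ⟨f, hf, hfT⟩
      rwa [← parentGraph_injective hf.1 hf.apply_root hf₀r (hfT.trans hf₀T.symm)]
    · exact fun h => ⟨f₀, h, hf₀T⟩
  let s : Finset (Fin n → Fin n) :=
    Finset.univ.filter fun f => f r = r ∧ LeadsTo r f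
  have h2 : {ω | ∃ f, Resolves r l ω f} = ⋃ f ∈ s, {ω | Resolves r l ω f} := by
    ext ω
    simp only [Set.mem_ofPred_eq, Set.mem_iUnion, exists_prop, s, Finset.mem_filter,
      Finset.mem_univ, true_and]
    exact ⟨fun ⟨f, hf⟩ => ⟨f, ⟨hf.apply_root, hf.1⟩, hf⟩, fun ⟨f, _, hf⟩ => ⟨f, hf⟩⟩
  have h3 : stackLaw G {ω | ∃ f, Resolves r l ω f} = (spanningTrees G).ncard * (κ * c) := by
    rw [h2, measure_biUnion_finset]
    · rw [Finset.sum_congr rfl fun f hf => hval f (Finset.mem_filter.1 hf).2.1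
        (Finset.mem_filter.1 hf).2.2, ← Finset.sum_filter, Finset.sum_const, nsmul_eq_mul]
      congr 2
      rw [← (bijOn_parentGraph r).image_eq, (bijOn_parentGraph r).injOn.ncard_image,
        ← Set.ncard_coe_finset]
      congr 1
      ext f
      simp [s, and_assoc]
    · intro f _ g _ hfg
      rw [Function.onFun, Set.disjoint_left]
      exact fun ω h h' => hfg (Resolves.unique h h')
    · exact fun f _ => measurableSet_resolves r l f
  have hN : (spanningTrees G).ncard ≠ 0 :=
    (Set.ncard_pos (Set.toFinite _)).2 ⟨T, hT⟩ |>.ne'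
  rw [h1, hval f₀ hf₀r hf₀, if_pos hf₀G, h3, ← mul_assoc,
    ENNReal.inv_mul_cancel (by exact_mod_cast hN) (ENNReal.natCast_ne_top _), one_mul]

/-- The walks from different vertices read the same stacks, so they are dependent; a union bound
suffices. -/
lemma stackLaw_not_resolves_le (r : Fin n) (l : Fin n → ℕ) :
    stackLaw G {ω | ¬ ∃ f, Resolves r l ω f} ≤
      ∑ v ∈ Finset.univ.erase r, stackLaw G {ω | ∀ t, ¬ Hits r v t v (l v) ω} := by
  refine le_trans (measure_mono ?_) (measure_biUnion_finset_le _ _)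
  intro ω hω
  by_contra hcon
  simp only [Set.mem_iUnion, Finset.mem_erase, Finset.mem_univ, and_true, Set.mem_ofPred_eq,
    exists_prop, not_exists, not_and, not_forall, not_not] at hcon
  obtain ⟨d, hd, hlead, hdl⟩ := exists_balanced_leadsTo hcon
  exact hω ⟨_, hlead, d, hd, rfl, hdl⟩

end Uniform

/-! ### Independent sampling -/

lemma indep_apply {α : Type} : ∀ {n : ℕ} (p : Fin n → PMF α) (x : Fin n → α),
    indep p x = ∏ i, p i (x i)
  | 0, p, x => by
    have : x = Fin.elim0 := Subsingleton.elim _ _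
    simp [indep, this]
  | n + 1, p, x => by
    classical
    rw [indep, PMF.bind_apply, Fin.prod_univ_succ]
    have h : ∀ a, ((indep (Fin.tail p)).map fun f => (Fin.cons a f : Fin (n + 1) → α)) x =
        if a = x 0 then ∏ i : Fin n, p i.succ (x i.succ) else 0 := by
      intro a
      rw [PMF.map_apply]
      split_ifs with ha
      · rw [tsum_eq_single (Fin.tail x)]
        · rw [if_pos, indep_apply]
          · rfl
          · rw [ha, Fin.cons_self_tail]
        · intro f hf
          rw [if_neg]
          rintro rfl
          exact hf (Fin.tail_cons (α := fun _ => α) a f).symm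
      · rw [ENNReal.tsum_eq_zero]
        intro f
        rw [if_neg]
        rintro rfl
        exact ha (by simp)
    simp only [h]
    rw [tsum_eq_single (x 0)]
    · simp
    · intro a ha
      simp [ha]

lemma indep_map {α β : Type} : ∀ {n : ℕ} (p : Fin n → PMF α) (g : Fin n → α → β),
    indep (fun i => (p i).map (g i)) = (indep p).map fun x i => g i (x i)
  | 0, p, g => by
    rw [indep, indep, PMF.pure_map]
    congr 1
    exact Subsingleton.elim _ _
  | n + 1, p, g => by
    have ht : Fin.tail (fun i => (p i).map (g i)) = fun i => (Fin.tail p i).map (Fin.tail g i) := rfl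
    rw [indep, indep, ht, indep_map, PMF.map_bind, PMF.bind_map]
    congr 1
    funext a
    simp only [Function.comp_apply, PMF.map_comp]
    congr 1
    funext f i
    refine Fin.cases ?_ (fun i => ?_) i <;> simp [Fin.tail]

/-! ### The schedule -/

/-- Two slots per machine suffice to give each vertex its share of the slots. -/
lemma exists_schedule {n : ℕ} [NeZero n] (D : Fin n → ℕ) :
    ∃ (c : Fin n → ℕ) (slot : Fin n → ℕ → Fin 2 × Fin n) (src : Fin 2 × Fin n → Fin n),
      (∀ v, n * D v ≤ (∑ w, D w) * c v) ∧ (∀ v k, src (slot v k) = v) ∧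
      ∀ v k k', slot v k = slot v k' → k % c v = k' % c v := by
  classical
  set S := ∑ w, D w with hS
  -- Rounding up costs at most one slot per vertex, so the total is at most `n + n`.
  let c : Fin n → ℕ := fun v => n * D v / S + 1
  have hc : ∀ v, 0 < c v := fun v => Nat.succ_pos _
  have hsum : ∑ v, c v ≤ 2 * n := by
    have h1 : ∑ v, n * D v / S ≤ n := by
      rcases Nat.eq_zero_or_pos S with h0 | h0
      · simp [h0]
      · refine Nat.le_of_mul_le_mul_left ?_ h0
        rw [Finset.mul_sum]
        calc ∑ v, S * (n * D v / S) ≤ ∑ v, n * D v :=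
              Finset.sum_le_sum fun v _ => Nat.mul_div_le _ _
          _ = S * n := by rw [← Finset.mul_sum, mul_comm]
    have h2 : ∑ v, c v = ∑ v, n * D v / S + n := by simp [c, Finset.sum_add_distrib]
    omega
  obtain ⟨e⟩ : Nonempty ((Σ v : Fin n, Fin (c v)) ↪ Fin 2 × Fin n) := by
    refine Function.Embedding.nonempty_of_card_le ?_
    simpa using hsum
  have : Nonempty (Σ v : Fin n, Fin (c v)) := ⟨⟨0, 0, hc 0⟩⟩
  -- Samples of `v` with the same residue modulo `c v` share a slot and are drawn in different
  -- rounds.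
  refine ⟨c, fun v k => e ⟨v, k % c v, Nat.mod_lt _ (hc v)⟩, fun s => (Function.invFun e s).1,
    fun v => ?_, fun v k => ?_, fun v k k' h => ?_⟩
  · rcases Nat.eq_zero_or_pos S with h0 | h0
    · have : D v = 0 := by
        have := Finset.single_le_sum (fun w _ => Nat.zero_le (D w)) (Finset.mem_univ v)
        omega
      simp [this]
    · exact (Nat.lt_mul_div_succ _ h0).le
  · exact congrArg Sigma.fst (Function.leftInverse_invFun e.injective _)
  · have := e.injective h
    simpa using this

section Schedule

variable {n : ℕ} [NeZero n] (D : Fin n → ℕ)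

/-- The number of samples per round from each vertex, given the degrees `D`. -/
def quota : Fin n → ℕ := (exists_schedule D).choose

/-- The slot that holds the sample `k` of a vertex. -/
def slot : Fin n → ℕ → Fin 2 × Fin n := (exists_schedule D).choose_spec.choose

/-- The vertex whose sample is held by a slot. -/
def source : Fin 2 × Fin n → Fin n := (exists_schedule D).choose_spec.choose_spec.choose

lemma le_mul_quota (v : Fin n) : n * D v ≤ (∑ w, D w) * quota D v :=
  (exists_schedule D).choose_spec.choose_spec.choose_spec.1 v

lemma source_slot (v : Fin n) (k : ℕ) : source D (slot D v k) = v :=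
  (exists_schedule D).choose_spec.choose_spec.choose_spec.2.1 v k

lemma slot_inj {v : Fin n} {k k' : ℕ} (h : slot D v k = slot D v k') :
    k % quota D v = k' % quota D v :=
  (exists_schedule D).choose_spec.choose_spec.choose_spec.2.2 v k k' h

end Schedule

/-! ### The algorithm -/

/-- The contents of a message: the degree of the sender, two samples of the sender to be relayed,
and two samples that the sender relays. -/
abbrev Content (n : ℕ) : Type := Fin n × (Fin 2 → Fin n) × (Fin 2 → Fin n)

/-- A message consists of five numbers below `n`, which explains the factor 5. -/
lemma exists_encoding (n : ℕ) : Nonempty (Content n ↪ Message 5 n) := by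
  refine Function.Embedding.nonempty_of_card_le ?_
  simp only [Fintype.card_prod, Fintype.card_fin, Fintype.card_fun, Fintype.card_bool]
  calc n * (n ^ 2 * n ^ 2) = n ^ 5 := by ring
    _ ≤ (2 ^ Nat.clog 2 n) ^ 5 := Nat.pow_le_pow_left (Nat.le_pow_clog one_lt_two n) 5
    _ = 2 ^ (5 * Nat.clog 2 n) := by rw [← pow_mul, mul_comm]

/-- The encoding of contents as bit strings. -/
def encode {n : ℕ} : Content n → Message 5 n := (exists_encoding n).some

/-- The contents of a bit string. -/
def decode {n : ℕ} [NeZero n] : Message 5 n → Content n := Function.invFun encode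

lemma decode_encode {n : ℕ} [NeZero n] (x : Content n) : decode (encode x) = x :=
  Function.leftInverse_invFun (exists_encoding n).some.injective x

/-- The state of a machine. -/
structure MachineState (n : ℕ) where
  /-- The neighbours of the hosted vertex. -/
  nbr : Set (Fin n)
  /-- The number of rounds so far. -/
  time : ℕ
  /-- The samples to be relayed in the next round. -/
  relay : Fin 2 → Fin n
  /-- The relayed samples received in each round. -/
  log : ℕ → Fin 2 × Fin n → Fin n
  /-- The output. -/
  out : Option (SimpleGraph (Fin n))

section Machine

variable {n : ℕ}

open Classical in
/-- A uniformly random element of `N` (or `i` if `N` is empty). -/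
def sampleLaw (i : Fin n) (N : Set (Fin n)) : PMF (Fin n) :=
  if h : N.toFinset.Nonempty then PMF.uniformOfFinset N.toFinset h else PMF.pure i

lemma sampleLaw_neighborSet (G : SimpleGraph (Fin n)) (i : Fin n) :
    sampleLaw i (G.neighborSet i) = walkStep G i := by
  classical
  unfold sampleLaw walkStep SimpleGraph.neighborFinset
  congr

/-- The samples drawn by a machine in a round. -/
def drawLaw (i : Fin n) (N : Set (Fin n)) : PMF (Fin 2 → Fin n → Fin n) :=
  indep fun _ => indep fun _ => sampleLaw i N

/-- The joint law of the samples of all machines in a round. -/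
def tableLaw (G : SimpleGraph (Fin n)) : PMF (Fin n → Fin 2 → Fin n → Fin n) :=
  indep fun i => drawLaw i (G.neighborSet i)

lemma tableLaw_apply (G : SimpleGraph (Fin n)) (a : Fin n → Fin 2 → Fin n → Fin n) :
    tableLaw G a = ∏ v, ∏ b, ∏ j, walkStep G v (a v b j) := by
  simp only [tableLaw, drawLaw, indep_apply, sampleLaw_neighborSet]

/-- The law of all samples. -/
def sampleSpaceLaw (G : SimpleGraph (Fin n)) : Measure (ℕ × Fin n × Fin 2 × Fin n → Fin n) :=
  Measure.infinitePi fun i => (walkStep G i.2.1).toMeasure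

instance (G : SimpleGraph (Fin n)) : IsProbabilityMeasure (sampleSpaceLaw G) := by
  unfold sampleSpaceLaw
  infer_instance

variable [NeZero n]

/-- The stacks of arrows that are read off the log; the relayed samples arrive one round late. -/
def stackOfLog (D : Fin n → ℕ) (log : ℕ → Fin 2 × Fin n → Fin n) (i : Fin n × ℕ) : Fin n :=
  log (i.2 / quota D i.1 + 1) (slot D i.1 i.2)

open Classical in
/-- The tree found by cycle popping on the stacks that are available after `b` batches. -/
def popTree (D : Fin n → ℕ) (b : ℕ) (log : ℕ → Fin 2 × Fin n → Fin n) :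
    Option (SimpleGraph (Fin n)) :=
  if h : ∃ f, Resolves 0 (fun v => b * quota D v) (stackOfLog D log) f then
    some (parentGraph h.choose) else none

/-- The contents of the message to machine `j`, given the samples `f`. -/
def content (s : MachineState n) (f : Fin 2 → Fin n → Fin n) (j : Fin n) : Content n :=
  -- A degree in a simple graph on `n` vertices is less than `n`, so reduction modulo `n` loses
  -- nothing.
  (Fin.ofNat n s.nbr.ncard, fun b => f b j, s.relay)

/-- The state after a round in which the contents `m` were received. -/
def update (i : Fin n) (s : MachineState n) (m : Fin n → Content n) : MachineState n where
  nbr := s.nbr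
  time := s.time + 1
  -- Degrees come with every message, so all machines compute the same schedule; only the samples
  -- assigned to the slots `(b, i)` are kept.
  relay b := (m (source (fun v => (m v).1) (b, i))).2.1 b
  log := Function.update s.log s.time fun x => (m x.2).2.2 x.1
  -- The log entry of round 0 holds dummies, so `s.time` batches are complete although `s.time + 1`
  -- rounds have passed.
  out := s.out.or (popTree (fun v => (m v).1) s.time
    (Function.update s.log s.time fun x => (m x.2).2.2 x.1))

variable (n) in
/-- Sampling of spanning trees by cycle popping: in each round the machines send samples of their
neighbours to relays, which broadcast them, so that all machines can pop cycles on the same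
stacks. -/
abbrev poppingAlgorithm : Algorithm 5 n where
  State := MachineState n
  init _ N := ⟨N, 0, fun _ => 0, fun _ _ => 0, none⟩
  compute i s := (drawLaw i s.nbr).map fun f => (s, fun j => encode (content s f j))
  receive i s m := update i s fun j => decode (m j)
  output s := s.out
  output_final i s T hs r hr m := by
    obtain ⟨f, -, rfl⟩ := (PMF.mem_support_map_iff _ _ _).1 hr
    simp [update, hs]

/-- One round with the samples `R`. -/
def roundMap (s : Fin n → MachineState n) (R : Fin n → Fin 2 → Fin n → Fin n) :
    Fin n → MachineState n :=
  fun i => update i (s i) fun j => content (s j) (R j) i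

/-- Separates the randomness of a round from its deterministic part, so that an execution becomes a
function of a table of samples. -/
lemma round_eq (G : SimpleGraph (Fin n)) {s : Fin n → MachineState n}
    (hs : ∀ i, (s i).nbr = G.neighborSet i) :
    (poppingAlgorithm n).round s = (tableLaw G).map (roundMap s) := by
  change ((indep fun i => (drawLaw i (s i).nbr).map fun f =>
    ((s i, fun j => encode (content (s i) f j)) : MachineState n × (Fin n → Message 5 n))).map
      fun r i => update i (r i).1 fun j => decode ((r j).2 i)) = _
  simp only [hs]
  rw [indep_map, PMF.map_comp, tableLaw]
  congr 1
  funext R i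
  simp only [Function.comp_apply, decode_encode]
  rfl

/-- The global state after `t` rounds, as a function of all samples. -/
def stateAfter (G : SimpleGraph (Fin n)) (R : ℕ × Fin n × Fin 2 × Fin n → Fin n) :
    ℕ → Fin n → MachineState n
  | 0 => fun i => (poppingAlgorithm n).init i (G.neighborSet i)
  | t + 1 => roundMap (stateAfter G R t) fun v b j => R (t, v, b, j)

lemma stateAfter_nbr (G : SimpleGraph (Fin n)) (R : ℕ × Fin n × Fin 2 × Fin n → Fin n) (t : ℕ)
    (i : Fin n) : (stateAfter G R t i).nbr = G.neighborSet i := by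
  induction t with
  | zero => rfl
  | succ t ih => exact ih

lemma stateAfter_time (G : SimpleGraph (Fin n)) (R : ℕ × Fin n × Fin 2 × Fin n → Fin n) (t : ℕ)
    (i : Fin n) : (stateAfter G R t i).time = t := by
  induction t with
  | zero => rfl
  | succ t ih => exact congrArg (· + 1) ih

lemma stateAfter_congr (G : SimpleGraph (Fin n)) {R R' : ℕ × Fin n × Fin 2 × Fin n → Fin n}
    {t : ℕ} (h : ∀ i, i.1 < t → R i = R' i) : stateAfter G R t = stateAfter G R' t := by
  induction t with
  | zero => rfl
  | succ t ih =>
    rw [stateAfter, stateAfter, ih fun i hi => h i (by omega)]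
    congr 1
    funext v b j
    exact h _ (Nat.lt_succ_self t)

end Machine

/-! ### The law of the algorithm -/

/-- For finite `S` and finite `α` this turns dependence on finitely many samples into measurability
and independence. -/
lemma exists_eq_restrict_preimage {ι α : Type*} (S : Finset ι) (A : Set (ι → α))
    (h : ∀ ω ω' : ι → α, (∀ i ∈ S, ω i = ω' i) → ω ∈ A → ω' ∈ A) :
    ∃ B : Set (S → α), A = (fun (ω : ι → α) (i : S) => ω i) ⁻¹' B := by
  refine ⟨(fun (ω : ι → α) (i : S) => ω i) '' A, Set.Subset.antisymm (Set.subset_preimage_image _ _)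
    ?_⟩
  rintro ω ⟨ω', hω', heq⟩
  exact h ω' ω (fun i hi => congrFun heq ⟨i, hi⟩) hω'

section Law

variable {n : ℕ} (G : SimpleGraph (Fin n))

lemma exists_table_preimage (t : ℕ) (a : Fin n → Fin 2 → Fin n → Fin n) :
    ∃ B : Set (({t} ×ˢ (Finset.univ : Finset (Fin n × Fin 2 × Fin n)) :
        Finset (ℕ × Fin n × Fin 2 × Fin n)) → Fin n),
      {R : ℕ × Fin n × Fin 2 × Fin n → Fin n | (fun v b j => R (t, v, b, j)) = a} =
        (fun R i => R i) ⁻¹' B := by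
  refine exists_eq_restrict_preimage _ _ fun R R' h hR => ?_
  have hR' : (fun v b j => R (t, v, b, j)) = a := hR
  change (fun v b j => R' (t, v, b, j)) = a
  rw [← hR']
  funext v b j
  exact (h (t, v, b, j) (by simp)).symm

lemma measurableSet_table (t : ℕ) (a : Fin n → Fin 2 → Fin n → Fin n) :
    MeasurableSet {R : ℕ × Fin n × Fin 2 × Fin n → Fin n | (fun v b j => R (t, v, b, j)) = a} := by
  obtain ⟨B, hB⟩ := exists_table_preimage t a
  rw [hB]
  exact (Set.to_countable B).measurableSet.preimage (by fun_prop)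

lemma sampleSpaceLaw_table (t : ℕ) (a : Fin n → Fin 2 → Fin n → Fin n) :
    sampleSpaceLaw G {R | (fun v b j => R (t, v, b, j)) = a} = tableLaw G a := by
  have : {R : ℕ × Fin n × Fin 2 × Fin n → Fin n | (fun v b j => R (t, v, b, j)) = a} =
      Set.pi ({t} ×ˢ (Finset.univ : Finset (Fin n × Fin 2 × Fin n)) : Finset _)
        fun i => {a i.2.1 i.2.2.1 i.2.2.2} := by
    ext R
    simp only [Set.mem_ofPred_eq, Set.mem_pi, Finset.mem_coe, Finset.mem_product,
      Finset.mem_singleton, Finset.mem_univ, and_true, Set.mem_singleton_iff]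
    constructor
    · rintro rfl ⟨_, v, b, j⟩ rfl
      rfl
    · intro h
      funext v b j
      exact h (t, v, b, j) rfl
  rw [this, sampleSpaceLaw, Measure.infinitePi_pi _ fun i _ => measurableSet_singleton _,
    Finset.prod_product, Finset.prod_singleton, tableLaw_apply]
  simp only [PMF.toMeasure_apply_singleton _ _ (measurableSet_singleton _), Fintype.prod_prod_type]

variable [NeZero n]

lemma exists_stateAfter_preimage (t : ℕ) (F : Set (Fin n → MachineState n)) :
    ∃ B : Set ((Finset.range t ×ˢ (Finset.univ : Finset (Fin n × Fin 2 × Fin n)) :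
        Finset (ℕ × Fin n × Fin 2 × Fin n)) → Fin n),
      {R | stateAfter G R t ∈ F} = (fun R i => R i) ⁻¹' B := by
  refine exists_eq_restrict_preimage _ _ fun R R' h hR => ?_
  have : stateAfter G R t = stateAfter G R' t := stateAfter_congr G fun i hi => h i (by simpa using hi)
  simpa only [Set.mem_ofPred_eq, this] using hR

lemma measurableSet_stateAfter (t : ℕ) (F : Set (Fin n → MachineState n)) :
    MeasurableSet {R | stateAfter G R t ∈ F} := by
  obtain ⟨B, hB⟩ := exists_stateAfter_preimage G t F
  rw [hB]
  exact (Set.to_countable B).measurableSet.preimage (by fun_prop)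

lemma sampleSpaceLaw_inter (t : ℕ) (F : Set (Fin n → MachineState n))
    (a : Fin n → Fin 2 → Fin n → Fin n) :
    sampleSpaceLaw G ({R | stateAfter G R t ∈ F} ∩ {R | (fun v b j => R (t, v, b, j)) = a}) =
      sampleSpaceLaw G {R | stateAfter G R t ∈ F} * tableLaw G a := by
  rw [← sampleSpaceLaw_table G t a]
  obtain ⟨B, hB⟩ := exists_stateAfter_preimage G t F
  obtain ⟨B', hB'⟩ := exists_table_preimage t a
  rw [hB, hB']
  have hdisj : Disjoint (Finset.range t ×ˢ (Finset.univ : Finset (Fin n × Fin 2 × Fin n)))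
      ({t} ×ˢ (Finset.univ : Finset (Fin n × Fin 2 × Fin n))) := by
    rw [Finset.disjoint_left]
    rintro ⟨s, i⟩ h1 h2
    simp only [Finset.mem_product, Finset.mem_range, Finset.mem_singleton] at h1 h2
    omega
  have hind := (iIndepFun_infinitePi
    (P := fun i : ℕ × Fin n × Fin 2 × Fin n => (walkStep G i.2.1).toMeasure)
    (X := fun _ x => x) fun _ => measurable_id).indepFun_finset _ _ hdisj
    fun i => measurable_pi_apply i
  exact hind.measure_inter_preimage_eq_mul _ _ (Set.to_countable _).measurableSet
    (Set.to_countable _).measurableSet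

/-- The law of the global state is the image of the law of all samples. -/
lemma run_toOuterMeasure (t : ℕ) (E : Set (Fin n → MachineState n)) :
    ((poppingAlgorithm n).run G t).toOuterMeasure E =
      sampleSpaceLaw G {R | stateAfter G R t ∈ E} := by
  classical
  induction t generalizing E with
  | zero =>
    change (PMF.pure (fun i => (poppingAlgorithm n).init i (G.neighborSet i))).toOuterMeasure E = _
    rw [PMF.toOuterMeasure_pure_apply]
    split_ifs with h
    · have : {R : ℕ × Fin n × Fin 2 × Fin n → Fin n | stateAfter G R 0 ∈ E} = Set.univ :=
        Set.eq_univ_of_forall fun R => h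
      rw [this, measure_univ]
    · have : {R : ℕ × Fin n × Fin 2 × Fin n → Fin n | stateAfter G R 0 ∈ E} = ∅ :=
        Set.eq_empty_of_forall_notMem fun R hR => h hR
      rw [this, measure_empty]
  | succ t ih =>
    change (((poppingAlgorithm n).run G t).bind (poppingAlgorithm n).round).toOuterMeasure E = _
    rw [PMF.toOuterMeasure_bind_apply]
    have hround : ∀ s : Fin n → MachineState n,
        (poppingAlgorithm n).run G t s * ((poppingAlgorithm n).round s).toOuterMeasure E =
        ∑ a, (poppingAlgorithm n).run G t s *
          (tableLaw G a * if roundMap s a ∈ E then 1 else 0) := by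
      intro s
      by_cases hs : (poppingAlgorithm n).run G t s = 0
      · simp [hs]
      · rw [← PMF.toOuterMeasure_apply_singleton, ih] at hs
        -- A state of positive probability is realised by some table of samples, so its machines
        -- know the right neighbourhoods.
        obtain ⟨R, hR⟩ := nonempty_of_measure_ne_zero hs
        have hnbr : ∀ i, (s i).nbr = G.neighborSet i := by
          intro i
          have : stateAfter G R t = s := hR
          rw [← this]
          exact stateAfter_nbr G R t i
        rw [round_eq G hnbr, PMF.toOuterMeasure_map_apply, PMF.toOuterMeasure_apply_fintype,
          Finset.mul_sum]
        refine Finset.sum_congr rfl fun a _ => ?_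
        congr 1
        simp [Set.indicator_apply]
    have hsum : {R | stateAfter G R (t + 1) ∈ E} = ⋃ a ∈ Finset.univ,
        ({R | stateAfter G R t ∈ {s | roundMap s a ∈ E}} ∩
          {R | (fun v b j => R (t, v, b, j)) = a}) := by
      ext R
      simp [stateAfter]
    rw [tsum_congr hround, Summable.tsum_finsetSum fun _ _ => ENNReal.summable, hsum,
      measure_biUnion_finset]
    · refine Finset.sum_congr rfl fun a _ => ?_
      rw [sampleSpaceLaw_inter, ← ih, PMF.toOuterMeasure_apply, ← ENNReal.tsum_mul_right]
      refine tsum_congr fun s => ?_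
      by_cases hs : roundMap s a ∈ E
      · simp [hs]
      · simp [hs]
    · intro a _ a' _ haa'
      rw [Function.onFun, Set.disjoint_left]
      rintro R ⟨-, h1⟩ ⟨-, h2⟩
      exact haa' (Eq.trans (Eq.symm h1) h2)
    · exact fun a _ => (measurableSet_stateAfter G t _).inter (measurableSet_table t a)

/-- The stacks that the machines build from the samples. -/
def sampleStacks (R : ℕ × Fin n × Fin 2 × Fin n → Fin n) (i : Fin n × ℕ) : Fin n :=
  R (i.2 / quota (deg G) i.1, i.1, slot (deg G) i.1 i.2)

/-- Different stack positions read different samples, since `k` is determined by its quotient and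
remainder modulo the quota; hence the arrows are independent. -/
lemma map_stacks : (sampleSpaceLaw G).map (sampleStacks G) = stackLaw G := by
  have hinj : Function.Injective fun i : Fin n × ℕ =>
      ((i.2 / quota (deg G) i.1, i.1, slot (deg G) i.1 i.2) : ℕ × Fin n × Fin 2 × Fin n) := by
    rintro ⟨v, k⟩ ⟨w, l⟩ h
    simp only [Prod.mk.injEq] at h
    obtain ⟨h1, rfl, h2⟩ := h
    have h3 := slot_inj _ h2
    rw [← Nat.div_add_mod k (quota (deg G) v), ← Nat.div_add_mod l (quota (deg G) v), h1, h3]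
  exact Measure.map_infinitePi_infinitePi_of_inj
    (P := fun i : ℕ × Fin n × Fin 2 × Fin n => (walkStep G i.2.1).toMeasure) hinj

lemma sampleSpaceLaw_stacks {E : Set (Fin n × ℕ → Fin n)} (hE : MeasurableSet E) :
    sampleSpaceLaw G {R | sampleStacks G R ∈ E} = stackLaw G E := by
  rw [← map_stacks, Measure.map_apply _ hE]
  · rfl
  · exact measurable_pi_lambda _ fun i => measurable_pi_apply _

lemma content_degrees (R : ℕ × Fin n × Fin 2 × Fin n → Fin n) (t : ℕ)
    (f : Fin n → Fin 2 → Fin n → Fin n) (i : Fin n) :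
    (fun v => ((content (stateAfter G R t v) (f v) i).1 : ℕ)) = deg G := by
  funext v
  simp only [content, stateAfter_nbr]
  exact Nat.mod_eq_of_lt (deg_lt G v)

lemma stateAfter_relay (R : ℕ × Fin n × Fin 2 × Fin n → Fin n) (t : ℕ) (i : Fin n) (b : Fin 2) :
    (stateAfter G R (t + 1) i).relay b = R (t, source (deg G) (b, i), b, i) := by
  simp only [stateAfter, roundMap, update]
  rw [content_degrees]
  rfl

/-- A sample drawn in round `u` reaches its relay in that round and is broadcast in round `u + 1`.
-/
lemma stateAfter_log (R : ℕ × Fin n × Fin 2 × Fin n → Fin n) {t u : ℕ} (hu : u + 1 < t) (i : Fin n)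
    (x : Fin 2 × Fin n) :
    (stateAfter G R t i).log (u + 1) x = R (u, source (deg G) x, x) := by
  induction t with
  | zero => omega
  | succ t ih =>
    simp only [stateAfter, roundMap, update, stateAfter_time]
    by_cases h : u + 1 = t
    · subst h
      rw [Function.update_self]
      exact stateAfter_relay G R u x.2 x.1
    · rw [Function.update_of_ne h]
      exact ih (by omega)

lemma stateAfter_out_succ (R : ℕ × Fin n × Fin 2 × Fin n → Fin n) (t : ℕ) (i : Fin n) :
    (stateAfter G R (t + 1) i).out =
      (stateAfter G R t i).out.or (popTree (deg G) t (stateAfter G R (t + 1) i).log) := by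
  simp only [stateAfter, roundMap, update, content_degrees, stateAfter_time]

lemma popTree_eq_some_iff {D : Fin n → ℕ} {b : ℕ} {log : ℕ → Fin 2 × Fin n → Fin n}
    {T : SimpleGraph (Fin n)} : popTree D b log = some T ↔
      ∃ f, Resolves 0 (fun v => b * quota D v) (stackOfLog D log) f ∧ parentGraph f = T := by
  unfold popTree
  constructor
  · intro h
    split_ifs at h with hex
    · exact ⟨_, hex.choose_spec, Option.some_injective _ h⟩
  · rintro ⟨f, hf, rfl⟩
    have hex : ∃ f, Resolves 0 (fun v => b * quota D v) (stackOfLog D log) f := ⟨f, hf⟩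
    rw [dif_pos hex, hex.choose_spec.unique hf]

lemma stackOfLog_stateAfter (R : ℕ × Fin n × Fin 2 × Fin n → Fin n) (t : ℕ) (i : Fin n)
    (v : Fin n) {k : ℕ} (hk : k < t * quota (deg G) v) :
    stackOfLog (deg G) (stateAfter G R (t + 1) i).log (v, k) = sampleStacks G R (v, k) := by
  have : k / quota (deg G) v < t := Nat.div_lt_of_lt_mul (by rwa [mul_comm])
  rw [stackOfLog, stateAfter_log G R (by simpa using this)]
  simp only [source_slot]
  rfl

/-- An output kept from an earlier round agrees with popping on the longer stacks, by uniqueness of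
the popping result. -/
lemma stateAfter_out (R : ℕ × Fin n × Fin 2 × Fin n → Fin n) (t : ℕ) (i : Fin n)
    (T : SimpleGraph (Fin n)) : (stateAfter G R (t + 1) i).out = some T ↔
      ∃ f, Resolves 0 (fun v => t * quota (deg G) v) (sampleStacks G R) f ∧ parentGraph f = T := by
  have hpop : ∀ t T, popTree (deg G) t (stateAfter G R (t + 1) i).log = some T ↔
      ∃ f, Resolves 0 (fun v => t * quota (deg G) v) (sampleStacks G R) f ∧ parentGraph f = T := by
    intro t T
    rw [popTree_eq_some_iff]
    have h : ∀ v, ∀ k < t * quota (deg G) v,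
        stackOfLog (deg G) (stateAfter G R (t + 1) i).log (v, k) = sampleStacks G R (v, k) :=
      fun v k hk => stackOfLog_stateAfter G R t i v hk
    exact exists_congr fun f => and_congr_left fun _ =>
      ⟨fun hf => hf.congr h, fun hf => hf.congr fun v k hk => (h v k hk).symm⟩
  induction t generalizing T with
  | zero =>
    rw [stateAfter_out_succ, ← hpop]
    have : (stateAfter G R 0 i).out = none := rfl
    rw [this, Option.none_or]
  | succ t ih =>
    rw [stateAfter_out_succ]
    cases hout : (stateAfter G R (t + 1) i).out with
    | none => rw [Option.none_or, hpop]
    | some T' =>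
      obtain ⟨f, hf, hfT⟩ := (ih T').1 hout
      have hf' : Resolves 0 (fun v => (t + 1) * quota (deg G) v) (sampleStacks G R) f :=
        hf.mono fun v => Nat.mul_le_mul_right _ (Nat.le_succ t)
      rw [Option.some_or]
      constructor
      · intro h
        exact ⟨f, hf', hfT.trans (Option.some_injective _ h)⟩
      · rintro ⟨f', hf'', rfl⟩
        rw [← hfT, hf'.unique hf'']

lemma measurableSet_exists_resolves (l : Fin n → ℕ) (P : (Fin n → Fin n) → Prop) :
    MeasurableSet {ω | ∃ f, Resolves 0 l ω f ∧ P f} := by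
  have : {ω | ∃ f, Resolves 0 l ω f ∧ P f} = ⋃ f, {ω | Resolves 0 l ω f} ∩ {_ω | P f} := by
    ext ω; simp
  rw [this]
  exact MeasurableSet.iUnion fun f => (measurableSet_resolves 0 l f).inter (MeasurableSet.const _)

end Law

/-! ### Correctness and round complexity -/

lemma two_le_of_ne {n : ℕ} {v w : Fin n} (h : v ≠ w) : 2 ≤ n := by
  have : Nontrivial (Fin n) := ⟨v, w, h⟩
  exact Fin.nontrivial_iff_two_le.1 this

section Main

variable {n : ℕ} [NeZero n] {G : SimpleGraph (Fin n)}

/-- The quota is at least `n deg v / ∑ deg` and the geometric mean at most `2 H deg v / ∑ deg`.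
Their ratio does not depend on `v`. -/
lemma stackLaw_unresolved_le (hG : G.Connected) {H : ℝ} (hH0 : 0 < H)
    (hH : ∀ r v, hittingTime (stepProb G) r v ≤ H) (b : ℕ) :
    stackLaw G {ω | ¬ ∃ f, Resolves 0 (fun v => b * quota (deg G) v) ω f} ≤
      ENNReal.ofReal (n * Real.exp (-(b * n / (2 * H)))) := by
  have hterm : ∀ v ∈ Finset.univ.erase (0 : Fin n),
      stackLaw G {ω | ∀ t, ¬ Hits 0 v t v (b * quota (deg G) v) ω} ≤
        ENNReal.ofReal (Real.exp (-(b * n / (2 * H)))) := by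
    intro v hv
    have hv0 := Finset.ne_of_mem_erase hv
    have hn := two_le_of_ne hv0
    obtain ⟨g, hg1, hg, hle⟩ := stackLaw_forall_not_hits_le hG hn hv0
    refine (hle _).trans (ENNReal.ofReal_le_ofReal (Real.exp_le_exp.2 (neg_le_neg ?_)))
    have hd : (0 : ℝ) < deg G v := Nat.cast_pos.2 (deg_pos hG hn v)
    have hS : (0 : ℝ) < ∑ x, (deg G x : ℝ) :=
      Finset.sum_pos (fun x _ => Nat.cast_pos.2 (deg_pos hG hn x)) ⟨v, Finset.mem_univ v⟩
    have hgle : g ≤ deg G v / (∑ x, (deg G x : ℝ)) * (2 * H) := by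
      rw [hg]
      refine mul_le_mul_of_nonneg_left ?_ (by positivity)
      linarith [hH 0 v, hH v 0]
    have hq : (n : ℝ) * deg G v ≤ (∑ x, (deg G x : ℝ)) * quota (deg G) v := by
      exact_mod_cast le_mul_quota (deg G) v
    rw [div_le_div_iff₀ (by positivity) (by linarith), Nat.cast_mul]
    generalize (∑ x, (deg G x : ℝ)) = S at hS hgle hq
    calc (b : ℝ) * n * g ≤ b * n * (deg G v / S * (2 * H)) :=
          mul_le_mul_of_nonneg_left hgle (by positivity)
      _ = b * (2 * H) / S * (n * deg G v) := by ring
      _ ≤ b * (2 * H) / S * (S * quota (deg G) v) :=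
          mul_le_mul_of_nonneg_left hq (by positivity)
      _ = b * quota (deg G) v * (2 * H) := by field_simp
  refine (stackLaw_not_resolves_le 0 _).trans ((Finset.sum_le_sum hterm).trans ?_)
  rw [Finset.sum_const, nsmul_eq_mul, ENNReal.ofReal_mul (Nat.cast_nonneg n),
    ENNReal.ofReal_natCast]
  refine mul_le_mul' (Nat.cast_le.2 ?_) le_rfl
  exact (Finset.card_le_univ _).trans_eq (Fintype.card_fin n)

lemma tendsto_stackLaw_resolved (hG : G.Connected) :
    Filter.Tendsto (fun b : ℕ =>
      stackLaw G {ω | ∃ f, Resolves 0 (fun v => b * quota (deg G) v) ω f})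
      Filter.atTop (nhds 1) := by
  -- Any finite bound on the hitting times serves for almost sure termination; their sum is one, and
  -- the 1 makes it positive.
  set H : ℝ := 1 + ∑ r, ∑ v, hittingTime (stepProb G) r v with hHdef
  have h0 : ∀ r v, 0 ≤ hittingTime (stepProb G) r v := fun r v =>
    hittingTime_nonneg (stepProb_nonneg G) v
  have hH0 : 0 < H := by
    have : 0 ≤ ∑ r, ∑ v, hittingTime (stepProb G) r v :=
      Finset.sum_nonneg fun r _ => Finset.sum_nonneg fun v _ => h0 r v
    linarith
  have hH : ∀ r v, hittingTime (stepProb G) r v ≤ H := by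
    intro r v
    have h1 := Finset.single_le_sum (fun v _ => h0 r v) (Finset.mem_univ v)
    have h2 := Finset.single_le_sum (f := fun r => ∑ v, hittingTime (stepProb G) r v)
      (fun r _ => Finset.sum_nonneg fun v _ => h0 r v) (Finset.mem_univ r)
    beta_reduce at h1 h2
    linarith
  have hlim : Filter.Tendsto (fun b : ℕ => 1 - ENNReal.ofReal (n * Real.exp (-(b * n / (2 * H)))))
      Filter.atTop (nhds 1) := by
    have hn0 : (0 : ℝ) < n := Nat.cast_pos.2 (Nat.pos_of_ne_zero (NeZero.ne n))
    have h1 : Filter.Tendsto (fun b : ℕ => (n : ℝ) * Real.exp (-(b * n / (2 * H))))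
        Filter.atTop (nhds 0) := by
      rw [← mul_zero (n : ℝ)]
      refine Filter.Tendsto.const_mul _ (Real.tendsto_exp_neg_atTop_nhds_zero.comp ?_)
      have : (fun b : ℕ => (b : ℝ) * n / (2 * H)) = fun b : ℕ => (b : ℝ) * (n / (2 * H)) := by
        funext b; ring
      rw [this]
      exact tendsto_natCast_atTop_atTop.atTop_mul_const (by positivity)
    have h2 := ENNReal.Tendsto.sub (tendsto_const_nhds (x := (1 : ℝ≥0∞)))
      (ENNReal.tendsto_ofReal h1) (Or.inl ENNReal.one_ne_top)
    simpa using h2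
  refine tendsto_of_tendsto_of_tendsto_of_le_of_le hlim tendsto_const_nhds (fun b => ?_)
    fun b => prob_le_one
  have hmeas : MeasurableSet {ω | ∃ f, Resolves 0 (fun v => b * quota (deg G) v) ω f} := by
    simpa using measurableSet_exists_resolves (fun v => b * quota (deg G) v) fun _ => True
  have hcompl := prob_compl_eq_one_sub (μ := stackLaw G) hmeas.compl
  rw [compl_compl] at hcompl
  change _ ≤ stackLaw G {ω | ∃ f, Resolves 0 (fun v => b * quota (deg G) v) ω f}
  rw [hcompl]
  exact tsub_le_tsub_left (stackLaw_unresolved_le hG hH0 hH b) 1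

/-- All machines output the tree found by popping. -/
lemma run_output (t : ℕ) (T : SimpleGraph (Fin n)) :
    ((poppingAlgorithm n).run G (t + 1)).toOuterMeasure
      {s | ∀ i, (poppingAlgorithm n).output (s i) = some T} =
      stackLaw G {ω | ∃ f, Resolves 0 (fun v => t * quota (deg G) v) ω f ∧ parentGraph f = T} := by
  rw [run_toOuterMeasure, ← sampleSpaceLaw_stacks G (measurableSet_exists_resolves _ _)]
  congr 1
  ext R
  change (∀ i, (stateAfter G R (t + 1) i).out = some T) ↔ _
  simp only [stateAfter_out, forall_const]
  rfl

/-- After each round, `T` has been output with probability `1 / N` times that of having finished,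
`N` being the number of spanning trees; the second factor tends to 1. -/
lemma samplesUniformSpanningTree (hG : G.Connected) :
    (poppingAlgorithm n).SamplesUniformSpanningTree G := by
  intro T hT
  have hpos : ∀ x ≠ (0 : Fin n), 0 < deg G x := fun x hx => deg_pos hG (two_le_of_ne hx) x
  have hout : ∀ t, ((poppingAlgorithm n).run G (t + 1)).toOuterMeasure
      {s | ∀ i, (poppingAlgorithm n).output (s i) = some T} =
      ((spanningTrees G).ncard : ℝ≥0∞)⁻¹ *
        stackLaw G {ω | ∃ f, Resolves 0 (fun v => t * quota (deg G) v) ω f} := fun t => by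
    rw [run_output, stackLaw_resolves_tree hpos _ hT]
  unfold Algorithm.probOutput
  refine le_antisymm (iSup_le fun t => ?_) ?_
  · cases t with
    | zero =>
      rw [run_toOuterMeasure]
      have : {R | stateAfter G R 0 ∈ {s | ∀ i, (poppingAlgorithm n).output (s i) = some T}} = ∅ :=
        Set.eq_empty_of_forall_notMem fun R hR => Option.some_ne_none T (hR 0).symm
      rw [this, measure_empty]
      exact bot_le
    | succ t =>
      rw [hout]
      exact mul_le_of_le_one_right' prob_le_one
  · have hN : (spanningTrees G).ncard ≠ 0 :=
      (Set.ncard_pos (Set.toFinite _)).2 ⟨T, hT⟩ |>.ne'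
    have hlim := ENNReal.Tendsto.const_mul (a := ((spanningTrees G).ncard : ℝ≥0∞)⁻¹)
      (tendsto_stackLaw_resolved hG) (Or.inl one_ne_zero)
    rw [mul_one] at hlim
    refine le_of_tendsto' hlim fun t => ?_
    rw [← hout]
    exact le_iSup (fun t => ((poppingAlgorithm n).run G t).toOuterMeasure
      {s | ∀ i, (poppingAlgorithm n).output (s i) = some T}) (t + 1)

lemma probUnfinished_succ_le (hG : G.Connected) {H : ℝ} (hH0 : 0 < H)
    (hH : ∀ r v, hittingTime (stepProb G) r v ≤ H) (b : ℕ) :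
    (poppingAlgorithm n).probUnfinished G (b + 1) ≤
      ENNReal.ofReal (n * Real.exp (-(b * n / (2 * H)))) := by
  refine le_trans ?_ (stackLaw_unresolved_le hG hH0 hH b)
  have hmeas : MeasurableSet {ω | ¬ ∃ f, Resolves 0 (fun v => b * quota (deg G) v) ω f} := by
    refine MeasurableSet.compl (s := {ω | ∃ f, Resolves 0 (fun v => b * quota (deg G) v) ω f}) ?_
    simpa using measurableSet_exists_resolves (fun v => b * quota (deg G) v) fun _ => True
  unfold Algorithm.probUnfinished
  rw [run_toOuterMeasure, ← sampleSpaceLaw_stacks G hmeas]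
  refine measure_mono fun R hR => ?_
  rintro ⟨f, hf⟩
  obtain ⟨i, hi⟩ := hR
  have hi' : (stateAfter G R (b + 1) i).out = none := hi
  rw [(stateAfter_out G R b i _).2 ⟨f, hf, rfl⟩] at hi'
  exact Option.some_ne_none _ hi'

lemma probUnfinished_le (hG : G.Connected) {τ : ℝ≥0} (hτ : coverTime G = τ) {c : ℝ} (hc : 0 < c)
    {t : ℕ} (ht : (2 * (c + 1) + 4) * ((τ : ℝ) / n * Real.log n ^ 1) ≤ t) :
    (poppingAlgorithm n).probUnfinished G t ≤ ENNReal.ofReal ((n : ℝ) ^ (-c)) := by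
  rcases Nat.lt_or_ge n 2 with hn | hn
  · have hn1 : n = 1 := by have := NeZero.ne n; omega
    have h1 : (n : ℝ) ^ (-c) = 1 := by rw [hn1]; simp
    unfold Algorithm.probUnfinished
    rw [h1, ENNReal.ofReal_one, run_toOuterMeasure]
    exact prob_le_one
  have hn2 : (2 : ℝ) ≤ n := by exact_mod_cast hn
  have hτn : (n : ℝ) - 1 ≤ τ := by
    have h := le_coverTime (G := G) 0
    rw [hτ, ← ENNReal.coe_natCast, ENNReal.coe_le_coe] at h
    have h' : ((n - 1 : ℕ) : ℝ) ≤ τ := by exact_mod_cast h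
    rwa [Nat.cast_sub (by omega), Nat.cast_one] at h'
  have hτ0 : (0 : ℝ) < τ := by linarith
  have hlog : 1 / 2 ≤ Real.log n :=
    le_trans (by linarith [Real.log_two_gt_d9]) (Real.log_le_log two_pos hn2)
  have hratio : 1 / 2 ≤ (τ : ℝ) / n := by
    rw [div_le_div_iff₀ two_pos (by linarith)]
    linarith
  -- Since `(τ / n) log n ≥ 1 / 4`, the summand 4 in the constant pays for the round by which
  -- relayed samples are late.
  have hprod : 1 / 2 * (1 / 2) ≤ (τ : ℝ) / n * Real.log n :=
    mul_le_mul hratio hlog (by norm_num) (by positivity)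
  rw [pow_one] at ht
  have ht1 : 2 * (c + 1) * ((τ : ℝ) / n * Real.log n) + 1 ≤ t := by linarith
  obtain ⟨b, rfl⟩ : ∃ b, t = b + 1 := by
    refine ⟨t - 1, ?_⟩
    have h1 : (0 : ℝ) ≤ 2 * (c + 1) * ((τ : ℝ) / n * Real.log n) :=
      mul_nonneg (by linarith) (by linarith)
    have h2 : (1 : ℝ) ≤ t := by linarith
    have h3 : 1 ≤ t := by exact_mod_cast h2
    omega
  refine (probUnfinished_succ_le hG hτ0 (hittingTime_le_coverTime hτ) b).trans
    (ENNReal.ofReal_le_ofReal ?_)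
  have hn0 : (0 : ℝ) < n := by linarith
  have hb : (c + 1) * Real.log n ≤ b * n / (2 * τ) := by
    rw [le_div_iff₀ (by positivity)]
    push_cast at ht1
    have h2 : 2 * (c + 1) * ((τ : ℝ) / n * Real.log n) * n ≤ b * n :=
      mul_le_mul_of_nonneg_right (by linarith) hn0.le
    calc (c + 1) * Real.log n * (2 * τ) = 2 * (c + 1) * ((τ : ℝ) / n * Real.log n) * n := by
          field_simp
      _ ≤ _ := h2
  -- The exponent `c + 1` leaves a factor `n` for the union bound.
  calc (n : ℝ) * Real.exp (-(b * n / (2 * τ))) ≤ n * Real.exp (-((c + 1) * Real.log n)) := by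
        gcongr
    _ = Real.exp (Real.log n) * Real.exp (-((c + 1) * Real.log n)) := by rw [Real.exp_log hn0]
    _ = (n : ℝ) ^ (-c) := by
        rw [← Real.exp_add, Real.rpow_def_of_pos hn0]
        congr 1
        ring

end Main

/-- The algorithm for the empty clique. -/
def emptyAlgorithm (B : ℕ) : Algorithm B 0 where
  State := Unit
  init i := i.elim0
  compute i := i.elim0
  receive i := i.elim0
  output _ := none
  output_final i := i.elim0

end CClique

end

theorem mainTheorem3 :
    ∃ (B k : ℕ) (A : (n : ℕ) → CClique.Algorithm B n),
      (∀ (n : ℕ) (G : SimpleGraph (Fin n)), G.Connected →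
        (A n).SamplesUniformSpanningTree G) ∧
      ∀ c : ℝ, 0 < c → ∃ C : ℝ, 0 < C ∧
        ∀ (n : ℕ) (G : SimpleGraph (Fin n)), G.Connected →
          ∀ τ : ℝ≥0, CClique.coverTime G = τ →
            ∀ t : ℕ, C * ((τ : ℝ) / n * Real.log n ^ k) ≤ t →
              (A n).probUnfinished G t ≤ ENNReal.ofReal ((n : ℝ) ^ (-c)) := by
  refine ⟨5, 1, fun n => match n with
    | 0 => CClique.emptyAlgorithm 5
    | n + 1 => CClique.poppingAlgorithm (n + 1), fun n G hG => ?_, fun c hc =>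
    ⟨2 * (c + 1) + 4, by linarith, fun n G hG τ hτ t ht => ?_⟩⟩
  -- A connected graph has a vertex, so the algorithm for `n = 0` is never tested.
  · cases n with
    | zero => exact hG.nonempty.some.elim0
    | succ n => exact CClique.samplesUniformSpanningTree hG
  · cases n with
    | zero => exact hG.nonempty.some.elim0
    | succ n => exact CClique.probUnfinished_le hG hτ hc ht
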